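/- Let $\mathcal O\subset\mathbb R^d$ be a bounded open set with smooth boundary (class $C^1$, with $\mathcal O$ locally on one side of $\partial\mathcal O$, is enough), and for $x\in\partial\mathcal O$ let $\mathbf n(x)$ be the set of unit outward normal vectors to $\partial\mathcal O$ at $x$. Assume that there are constants $C_0\ge 0$, $\alpha>0$ and a function $\phi\in C^2_b(\mathbb R^d)$ (that is, $C^2$ and bounded together with its derivatives of order one and two) such that: 1. for all $x\in\partial\mathcal O$, $x'\in\bar{\mathcal O}$ and $\nu\in\mathbf n(x)$, $\ (x-x',\nu)+C_0|x-x'|^2\ge 0$; 2. for all $x\in\partial\mathcal O$ and $k\in\mathbb R^d$, if there is $C\ge0$ with $(x-x',k)+C|x-x'|^2\ge 0$ for all $x'\in\bar{\mathcal O}$, then $k=\theta\nu$ for some $\theta\ge 0$ and $\nu\in\mathbf n(x)$; 3. for all $x\in\partial\mathcal O$ and $\zeta\in\mathbf n(x)$, $\ (\nabla\phi(x),\zeta)\le-\alpha C_0$. Let $b:\mathbb R^d\to\mathbb R^d$ and $\sigma:\mathbb R^d\to\mathbb R^{d\times d}$ be bounded and uniformly Lipschitz. For $x\in\bar{\mathcal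 O}$ and $\psi\in L^2([0,1];\mathbb R^d)$, a solution of the skeleton equation is a pair $(z,k)$ of continuous functions $z:[0,1]\to\bar{\mathcal O}$, $k:[0,1]\to\mathbb R^d$, with $k$ of bounded variation, $k_0=0$, such that for all $t\in[0,1]$ $$z_t=x+\int_0^t b(z_s)\,ds+\int_0^t\sigma(z_s)\psi(s)\,ds-k_t,\qquad k_t=\int_0^t\xi(z_s)\,d|k|_s,\qquad |k|_t=\int_0^t \mathbf 1_{\{z_s\in\partial\mathcal O\}}\,d|k|_s,$$ where $|k|_t$ is the total variation of $k$ on $[0,t]$ and $\xi(y)\in\mathbf n(y)$ for $y\in\partial\mathcal O$. Then for every $x\in\bar{\mathcal O}$ and every $\psi\in L^2([0,1];\mathbb R^d)$ the skeleton equation has a unique solution $(z^\psi(x),k^\psi(x))$. Moreover, for every $r>0$ there is a constant $c(r)>0$ (independent of $x$, $t$, $\psi_1$, $\psi_2$) such that, for all $x\in\bar{\mathcal O}$, all $\psi_1,\psi_2\in L^2([0,1];\mathbb R^d)$ with $\|\psi_i\|_{L^2}^2\le r$, $i=1,2$, and all $t\in[0,1]$, $$\|z^{\psi_1}(x)-z^{\psi_2}(x)\|_t^2\le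 c(r)\int_0^t|\psi_1(s)-\psi_2(s)|^2\,ds\qquad\text{and}\qquad \|z^{\psi_1}(x)-z^{\psi_2}(x)\|_t^2\le c(r)\int_0^t\|\psi_1-\psi_2\|_s^2\,ds,$$ where $\|f\|_t=\sup_{s\in[0,t]}|f(s)|\in[0,\infty]$. -/

import Mathlib

open MeasureTheory Set
open scoped ENNReal

noncomputable section

namespace ReflectedSkeleton

variable {E : Type*} [NormedAddCommGroup E] [InnerProductSpace ℝ E] [CompleteSpace E]

/-! ### Domains and their normals -/

/-- Near the point `x`, the set `O` is the strict sublevel set `{ρ < 0}` of the `C¹` function `ρ`,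
whose gradient does not vanish at `x`; `U` is the neighbourhood on which this holds. -/
structure IsLocalDefiningFunction (O : Set E) (x : E) (U : Set E) (ρ : E → ℝ) : Prop where
  isOpen : IsOpen U
  mem : x ∈ U
  contDiffOn : ContDiffOn ℝ 1 ρ U
  gradient_ne_zero : gradient ρ x ≠ 0
  inter_eq : O ∩ U = {y ∈ U | ρ y < 0}

/-- `O` has a `C¹` boundary and lies locally on one side of it. Every `C^∞` domain is of this kind;
no regularity beyond the existence of the normal field is asked for. -/
def HasSmoothBoundary (O : Set E) : Prop :=
  ∀ x ∈ frontier O, ∃ U ρ, IsLocalDefiningFunction O x U ρ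

/-- The set `n(x)` of unit outward normal vectors to `∂O` at `x ∈ ∂O`: the normalized gradients of
the local defining functions (empty when `x ∉ ∂O`). -/
def outwardNormals (O : Set E) (x : E) : Set E :=
  {ν | x ∈ frontier O ∧ ∃ U ρ, IsLocalDefiningFunction O x U ρ ∧
    ν = ‖gradient ρ x‖⁻¹ • gradient ρ x}

/-- Outward normals satisfy `(x - x', ν) + C₀ |x - x'|² ≥ 0` for all `x' ∈ closure O`. -/
def NormalInequality (O : Set E) (C₀ : ℝ) : Prop :=
  ∀ x ∈ frontier O, ∀ x' ∈ closure O, ∀ ν ∈ outwardNormals O x,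
    0 ≤ inner ℝ (x - x') ν + C₀ * ‖x - x'‖ ^ 2

/-- A vector `k` satisfying `(x - x', k) + C |x - x'|² ≥ 0` for some `C ≥ 0` and all
`x' ∈ closure O` is a nonnegative multiple of an outward normal at `x`. -/
def NormalCharacterization (O : Set E) : Prop :=
  ∀ x ∈ frontier O, ∀ k : E,
    (∃ C : ℝ, 0 ≤ C ∧ ∀ x' ∈ closure O, 0 ≤ inner ℝ (x - x') k + C * ‖x - x'‖ ^ 2) →
      ∃ θ : ℝ, 0 ≤ θ ∧ ∃ ν ∈ outwardNormals O x, k = θ • ν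

/-- The class `C_b²`: twice continuously differentiable, bounded together with the derivatives of
first and second order. -/
def IsCb2 (φ : E → ℝ) : Prop :=
  ContDiff ℝ 2 φ ∧ ∃ M : ℝ, ∀ i : ℕ, i ≤ 2 → ∀ x, ‖iteratedFDeriv ℝ i φ x‖ ≤ M

/-! ### Total variation -/

/-- The total variation `|k|_t` of `k` on `[0, t]`, for `t ∈ [0, 1]`; it is extended to the whole
line by `0` for `t < 0` and by `|k|_1` for `t > 1`. -/
def totalVariation (k : ℝ → E) (t : ℝ) : ℝ := (eVariationOn k (Icc 0 (min t 1))).toReal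

theorem monotone_totalVariation {F : Type*} [NormedAddCommGroup F] [InnerProductSpace ℝ F]
    [CompleteSpace F] {k : ℝ → F} (hk : BoundedVariationOn k (Icc 0 1)) :
    Monotone (totalVariation k) := by
  intro s t hst
  have h : eVariationOn k (Icc 0 (min t 1)) ≠ ∞ :=
    (hk.mono (Icc_subset_Icc_right (min_le_right t 1)))
  exact ENNReal.toReal_mono h
    (eVariationOn.mono k (Icc_subset_Icc_right (min_le_min_right 1 hst)))

/-- The Lebesgue-Stieltjes measure `d|k|` on the line of a function `k` of bounded variation on
`[0, 1]`. -/
def variationMeasure (k : ℝ → E) (hk : BoundedVariationOn k (Icc 0 1)) : Measure ℝ :=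
  (monotone_totalVariation hk).stieltjesFunction.measure

/-! ### The skeleton equation -/

/-- The pair `(z, k)` is a solution on `[0, 1]` of the skeleton equation in `closure O` with
coefficients `b`, `σ`, control `ψ` and initial value `x`. The functions are defined on the whole
line, but only their restrictions to `[0, 1]` matter. -/
structure IsSkeletonSolution (O : Set E) (b : E → E) (σ : E → E →L[ℝ] E) (x : E) (ψ : ℝ → E)
    (z k : ℝ → E) : Prop where
  continuousOn_z : ContinuousOn z (Icc 0 1)
  continuousOn_k : ContinuousOn k (Icc 0 1)
  mem_closure : ∀ t ∈ Icc (0 : ℝ) 1, z t ∈ closure O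
  k_zero : k 0 = 0
  /-- `z_t = x + ∫₀ᵗ b(z_s) ds + ∫₀ᵗ σ(z_s) ψ(s) ds - k_t` -/
  equation : ∀ t ∈ Icc (0 : ℝ) 1,
    z t = x + (∫ s in (0 : ℝ)..t, b (z s)) + (∫ s in (0 : ℝ)..t, σ (z s) (ψ s)) - k t
  /-- `k` has bounded variation, `k_t = ∫₀ᵗ ξ(z_s) d|k|_s` with `ξ(y) ∈ n(y)` for `y ∈ ∂O`, and
  `|k|_t = ∫₀ᵗ 1_{z_s ∈ ∂O} d|k|_s` -/
  reflection : ∃ hk : BoundedVariationOn k (Icc 0 1),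
    (∃ ξ : E → E, (∀ y ∈ frontier O, ξ y ∈ outwardNormals O y) ∧
      IntegrableOn (fun s => ξ (z s)) (Icc 0 1) (variationMeasure k hk) ∧
      ∀ t ∈ Icc (0 : ℝ) 1, k t = ∫ s in Icc 0 t, ξ (z s) ∂(variationMeasure k hk)) ∧
    ∀ t ∈ Icc (0 : ℝ) 1, ENNReal.ofReal (totalVariation k t) =
      ∫⁻ s in Icc 0 t, {u | z u ∈ frontier O}.indicator 1 s ∂(variationMeasure k hk)

/-- `‖f‖_t = sup_{s ∈ [0, t]} |f(s)|`, with values in `[0, ∞]`. -/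
def supNorm (f : ℝ → E) (t : ℝ) : ℝ≥0∞ := ⨆ s ∈ Icc (0 : ℝ) t, ‖f s‖ₑ

end ReflectedSkeleton

end

open MeasureTheory Set
open scoped ENNReal

noncomputable section

/-! ### Local geometry of the boundary and projection onto the closed domain. -/

namespace ReflectedSkeleton

variable {E : Type*} [NormedAddCommGroup E] [InnerProductSpace ℝ E] [CompleteSpace E]

/-! Stability. In `|z₁ - z₂|²` the reflection terms contribute, by condition 1, at most `2 C₀ |z₁ -
z₂|² (d|k₁| + d|k₂|)`, and no a priori bound on these measures is at hand. The weight
`exp(-(2/α)(φ(z₁) + φ(z₂)))` cancels this: along a reflection it produces `(2/α)(∇φ, ν) ≤ -2 C₀` by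
condition 3 (`reflection_drift_nonpos`). A second weight `exp(-A)`, with `A` the integral of an
affine function of `|ψ₁| + |ψ₂|`, absorbs the Lipschitz terms (`drift_bound`). Only `S² |ψ₁ - ψ₂|²`
is left, where `S` bounds `σ`, and both weights are bounded above and below in terms of `r`. The
computation rests on `chain_rule`, valid for continuous paths driven by several measures; it gives
`stability`, and uniqueness is the case `ψ₁ = ψ₂`.

Existence. The catching-up scheme freezes the state on each cell of a grid, moves it by the
integrated field and projects back to a nearest point of the closure. Conditions 1 and 2 turn
minimality into a normal cone inequality whose constant is proportional to the displacement
(`exists_projection_step`), so the errors add up along the grid (`projected_chain_estimates`). All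
increments are dominated by those of one continuous function, whence a uniform limit `(z, k)`
(`exists_limit`).

The increments of `k` are dominated by an integral, so `k` has a density `h` (`exists_density`).
Differentiating the limiting cone inequality shows that `h` vanishes while `z` is in the interior
and is a nonnegative multiple of the outward normal otherwise (`density_eq_norm_smul_normal`). Since
`d|k| = |h| dt`, this is the reflection condition. -/

theorem IsLocalDefiningFunction.hasGradientAt {O U : Set E} {x : E} {ρ : E → ℝ}
    (h : IsLocalDefiningFunction O x U ρ) : HasGradientAt ρ (gradient ρ x) x :=
  ((h.contDiffOn.contDiffAt (h.isOpen.mem_nhds h.mem)).differentiableAt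
    one_ne_zero).hasGradientAt

theorem IsLocalDefiningFunction.eq_zero {O U : Set E} {x : E} {ρ : E → ℝ}
    (h : IsLocalDefiningFunction O x U ρ) (hO : IsOpen O) (hx : x ∈ frontier O) : ρ x = 0 := by
  apply le_antisymm
  · by_contra! hpos
    have hc : ContinuousAt ρ x := h.hasGradientAt.continuousAt
    have hev : ∀ᶠ y in nhds x, 0 < ρ y ∧ y ∈ U :=
      (hc.eventually (lt_mem_nhds hpos)).and (h.isOpen.mem_nhds h.mem)
    obtain ⟨y, hyO, hy⟩ := (mem_closure_iff_frequently.1 hx.1).and_eventually hev |>.exists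
    have : y ∈ {y ∈ U | ρ y < 0} := h.inter_eq ▸ ⟨hyO, hy.2⟩
    linarith [this.2, hy.1]
  · by_contra! hneg
    have : x ∈ O ∩ U := h.inter_eq ▸ ⟨h.mem, hneg⟩
    rw [hO.frontier_eq] at hx
    exact hx.2 this.1

/-- Directions making an obtuse angle with the gradient of a defining function point into `O`, and
directions making an acute angle with it point out of `O`. -/
theorem IsLocalDefiningFunction.eventually_mem {O U : Set E} {x v : E} {ρ : E → ℝ}
    (h : IsLocalDefiningFunction O x U ρ) (hO : IsOpen O) (hx : x ∈ frontier O) :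
    (inner ℝ (gradient ρ x) v < 0 → ∀ᶠ t in nhdsWithin (0 : ℝ) (Ioi 0), x + t • v ∈ O) ∧
    (0 < inner ℝ (gradient ρ x) v → ∀ᶠ t in nhdsWithin (0 : ℝ) (Ioi 0), x + t • v ∉ O) := by
  have hline : HasDerivAt (fun t : ℝ => x + t • v) v 0 := by
    simpa using ((hasDerivAt_id (0 : ℝ)).smul_const v).const_add x
  have hd : HasDerivAt (fun t : ℝ => ρ (x + t • v)) (inner ℝ (gradient ρ x) v) 0 := by
    have h1 := h.hasGradientAt.hasFDerivAt
    have h2 : HasFDerivAt ρ (InnerProductSpace.toDual ℝ E (gradient ρ x)) (x + (0 : ℝ) • v) := by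
      simpa using h1
    exact h2.comp_hasDerivAt (0 : ℝ) hline
  have hU : ∀ᶠ t in nhdsWithin (0 : ℝ) (Ioi 0), x + t • v ∈ U := by
    have : ContinuousAt (fun t : ℝ => x + t • v) 0 := hline.continuousAt
    refine nhdsWithin_le_nhds (this ?_)
    simpa using h.isOpen.mem_nhds h.mem
  have h0 := h.eq_zero hO hx
  have hs := (hasDerivWithinAt_iff_tendsto_slope' (lt_irrefl (0 : ℝ) |> fun h => by simp)).1
    (hd.hasDerivWithinAt (s := Ioi 0))
  constructor
  · intro hv
    filter_upwards [hU, hs.eventually (gt_mem_nhds hv), self_mem_nhdsWithin] with t htU ht htpos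
    have htpos : 0 < t := htpos
    have : x + t • v ∈ O ∩ U := by
      rw [h.inter_eq]
      refine ⟨htU, ?_⟩
      simp only [slope_def_field, zero_smul, add_zero, h0, sub_zero] at ht
      by_contra! hc
      exact absurd ht (not_lt.2 (by positivity))
    exact this.1
  · intro hv
    filter_upwards [hU, hs.eventually (lt_mem_nhds hv), self_mem_nhdsWithin] with t htU ht htpos
    have htpos : 0 < t := htpos
    intro hc
    have : x + t • v ∈ {y ∈ U | ρ y < 0} := h.inter_eq ▸ ⟨hc, htU⟩
    simp only [slope_def_field, zero_smul, add_zero, h0, sub_zero] at ht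
    have h3 : ρ (x + t • v) / t < 0 := div_neg_of_neg_of_pos this.2 htpos
    linarith

theorem norm_eq_one_of_mem_outwardNormals {O : Set E} {x ν : E} (h : ν ∈ outwardNormals O x) :
    ‖ν‖ = 1 := by
  obtain ⟨-, U, ρ, hρ, rfl⟩ := h
  rw [norm_smul, norm_inv, norm_norm, inv_mul_cancel₀ (norm_ne_zero_iff.2 hρ.gradient_ne_zero)]

/-- For distinct unit normals the direction `ν' - ν` makes an obtuse angle with `ν` and an acute one
with `ν'`, hence would point both into and out of `O`. Uniqueness identifies the normal supplied by
condition 2 with a normal field chosen beforehand. -/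
theorem outwardNormals_unique {O : Set E} (hO : IsOpen O) {x ν ν' : E}
    (h : ν ∈ outwardNormals O x) (h' : ν' ∈ outwardNormals O x) : ν = ν' := by
  have hn := norm_eq_one_of_mem_outwardNormals h
  have hn' := norm_eq_one_of_mem_outwardNormals h'
  obtain ⟨hx, U, ρ, hρ, hν⟩ := h
  obtain ⟨-, U', ρ', hρ', hν'⟩ := h'
  by_contra hne
  have hlt : inner ℝ ν ν' < 1 := inner_lt_one_iff_real_of_norm_eq_one hn hn' |>.2 hne
  have hg : gradient ρ x = ‖gradient ρ x‖ • ν := by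
    rw [hν, smul_smul, mul_inv_cancel₀ (norm_ne_zero_iff.2 hρ.gradient_ne_zero), one_smul]
  have hg' : gradient ρ' x = ‖gradient ρ' x‖ • ν' := by
    rw [hν', smul_smul, mul_inv_cancel₀ (norm_ne_zero_iff.2 hρ'.gradient_ne_zero), one_smul]
  have hp : 0 < ‖gradient ρ x‖ := norm_pos_iff.2 hρ.gradient_ne_zero
  have hp' : 0 < ‖gradient ρ' x‖ := norm_pos_iff.2 hρ'.gradient_ne_zero
  have h1 : inner ℝ (gradient ρ x) (ν' - ν) < 0 := by
    rw [hg, real_inner_smul_left, inner_sub_right, real_inner_self_eq_norm_sq, hn]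
    nlinarith
  have h2 : 0 < inner ℝ (gradient ρ' x) (ν' - ν) := by
    rw [hg', real_inner_smul_left, inner_sub_right, real_inner_self_eq_norm_sq, hn',
      real_inner_comm]
    exact mul_pos hp' (by linarith)
  obtain ⟨t, ht, ht'⟩ := (((hρ.eventually_mem hO hx).1 h1).and
    ((hρ'.eventually_mem hO hx).2 h2)).exists
  exact ht' ht

theorem HasSmoothBoundary.outwardNormals_nonempty {O : Set E} (hO : HasSmoothBoundary O) {x : E}
    (hx : x ∈ frontier O) : (outwardNormals O x).Nonempty := by
  obtain ⟨U, ρ, h⟩ := hO x hx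
  exact ⟨_, hx, U, ρ, h, rfl⟩

theorem exists_normalField {O : Set E} (hO : HasSmoothBoundary O) :
    ∃ ξ : E → E, ∀ y ∈ frontier O, ξ y ∈ outwardNormals O y := by
  classical
  exact ⟨fun y => if h : y ∈ frontier O then (hO.outwardNormals_nonempty h).some else 0,
    fun y hy => by simpa [hy] using (hO.outwardNormals_nonempty hy).some_mem⟩

/-- A vector that satisfies the inequality of an inner normal cone up to a quadratic term vanishes
in the interior. -/
theorem eq_zero_of_forall_inner_add_sq_nonneg {F : Type*} [NormedAddCommGroup F]
    [InnerProductSpace ℝ F] {O : Set F} (hO : IsOpen O) {p v : F} (hp : p ∈ O)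
    {C : ℝ} (h : ∀ x' ∈ closure O, 0 ≤ inner ℝ (p - x') v + C * ‖p - x'‖ ^ 2) : v = 0 := by
  have hc : ContinuousAt (fun t : ℝ => p + t • v) 0 := by fun_prop
  have hev : ∀ᶠ t in nhdsWithin (0 : ℝ) (Ioi 0), p + t • v ∈ O :=
    nhdsWithin_le_nhds (hc (by simpa using hO.mem_nhds hp))
  have hlim : Filter.Tendsto (fun t : ℝ => t * (C * ‖v‖ ^ 2)) (nhdsWithin (0 : ℝ) (Ioi 0))
      (nhds (0 * (C * ‖v‖ ^ 2))) :=
    ((continuous_id.mul continuous_const).tendsto (0 : ℝ)).mono_left nhdsWithin_le_nhds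
  have hle : ‖v‖ ^ 2 ≤ 0 * (C * ‖v‖ ^ 2) := by
    refine ge_of_tendsto hlim ?_
    -- Testing with `x' = p + t v` gives `|v|² ≤ t C |v|²`, and `t → 0`.
    filter_upwards [hev, self_mem_nhdsWithin] with t ht htpos
    have htpos : 0 < t := htpos
    have := h _ (subset_closure ht)
    rw [sub_add_cancel_left, inner_neg_left, real_inner_smul_left, real_inner_self_eq_norm_sq,
      norm_neg, norm_smul, Real.norm_eq_abs, abs_of_pos htpos] at this
    have h2 : 0 ≤ t * (t * (C * ‖v‖ ^ 2) - ‖v‖ ^ 2) := by nlinarith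
    nlinarith [nonneg_of_mul_nonneg_right h2 htpos]
  have : ‖v‖ = 0 := by nlinarith [norm_nonneg v]
  exact norm_eq_zero.1 this

/-- Nearest points: a displacement `v` from a point of `closure O`, followed by a projection. -/
theorem exists_projection_step [FiniteDimensional ℝ E] {O : Set E} (hO : IsOpen O)
    {C₀ : ℝ} (hC₀ : 0 ≤ C₀) (hineq : NormalInequality O C₀)
    (hchar : NormalCharacterization O) {z : E} (hz : z ∈ closure O) (v : E) :
    ∃ p ∈ closure O, ‖z + v - p‖ ≤ ‖v‖ ∧ ∀ x' ∈ closure O,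
      0 ≤ inner ℝ (p - x') (z + v - p) + C₀ * ‖v‖ * ‖p - x'‖ ^ 2 := by
  have : ProperSpace E := FiniteDimensional.proper_real E
  obtain ⟨p, hp, hdist⟩ := isClosed_closure.exists_infDist_eq_dist ⟨z, hz⟩ (z + v)
  have hmin : ∀ x' ∈ closure O, ‖z + v - p‖ ≤ ‖z + v - x'‖ := by
    intro x' hx'
    rw [← dist_eq_norm, ← dist_eq_norm, ← hdist]
    exact Metric.infDist_le_dist_of_mem hx'
  have hle : ‖z + v - p‖ ≤ ‖v‖ := by simpa using hmin z hz
  refine ⟨p, hp, hle, ?_⟩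
  -- Expanding `|q|² ≤ |q + (p - x')|²` with `q = z + v - p` gives the constant `1 / 2`. It does not
  -- shrink with `v`, so it would be useless in a sum over a fine grid; it only serves to invoke
  -- condition 2.
  have hprox : ∀ x' ∈ closure O, 0 ≤ inner ℝ (p - x') (z + v - p) + 1 / 2 * ‖p - x'‖ ^ 2 := by
    intro x' hx'
    have h1 := hmin x' hx'
    have h2 : z + v - x' = (z + v - p) + (p - x') := by abel
    have h3 : ‖z + v - p‖ ^ 2 ≤ ‖z + v - x'‖ ^ 2 := by gcongr
    rw [h2, norm_add_sq_real, real_inner_comm] at h3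
    linarith
  by_cases hpO : p ∈ O
  · rw [eq_zero_of_forall_inner_add_sq_nonneg hO hpO hprox]
    intro x' _
    rw [inner_zero_right, zero_add]
    positivity
  · have hfr : p ∈ frontier O := by rw [hO.frontier_eq]; exact ⟨hp, hpO⟩
    obtain ⟨θ, hθ, ν, hν, hk⟩ := hchar p hfr _ ⟨1 / 2, by norm_num, hprox⟩
    have hθn : θ = ‖z + v - p‖ := by
      rw [hk, norm_smul, norm_eq_one_of_mem_outwardNormals hν, mul_one, Real.norm_of_nonneg hθ]
    intro x' hx'
    -- Condition 1, scaled by `θ = |q| ≤ |v|`, improves the constant to `C₀ |v|`.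
    have h1 := hineq p hfr x' hx' ν hν
    rw [hk, real_inner_smul_right]
    have h2 : 0 ≤ θ * (inner ℝ (p - x') ν + C₀ * ‖p - x'‖ ^ 2) := mul_nonneg hθ h1
    have h3 : θ * (C₀ * ‖p - x'‖ ^ 2) ≤ ‖v‖ * (C₀ * ‖p - x'‖ ^ 2) := by
      gcongr
      exact hθn.trans_le hle
    nlinarith

end ReflectedSkeleton

/-! ### A chain rule for paths driven by several measures. -/

namespace ReflectedSkeleton

/-- An interval property that is additive and holds on short intervals holds on `[a, b]`. -/
theorem interval_induction {P : ℝ → ℝ → Prop} {a b : ℝ} (hab : a ≤ b)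
    (hadd : ∀ r s t, a ≤ r → r ≤ s → s ≤ t → t ≤ b → P r s → P s t → P r t)
    (hloc : ∀ u ∈ Icc a b, ∃ V ∈ nhds u, ∀ v ∈ V, ∀ v' ∈ V,
      v ∈ Icc a b → v' ∈ Icc a b → v ≤ v' → P v v') : P a b := by
  have hloc' : ∀ u : Icc a b, ∃ V : Set ℝ, IsOpen V ∧ (u : ℝ) ∈ V ∧
      ∀ v ∈ V, ∀ v' ∈ V, v ∈ Icc a b → v' ∈ Icc a b → v ≤ v' → P v v' := by
    intro u
    obtain ⟨V, hV, h⟩ := hloc u u.2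
    obtain ⟨U, hUV, hU, hu⟩ := mem_nhds_iff.1 hV
    exact ⟨U, hU, hu, fun v hv v' hv' => h v (hUV hv) v' (hUV hv')⟩
  choose V hVo hVm hV using hloc'
  -- Compactness yields a finite partition with each cell inside one of the neighbourhoods.
  obtain ⟨t, ht0, htm, ⟨m, hm⟩, ht⟩ := exists_monotone_Icc_subset_open_cover_Icc hab
    (c := fun u : Icc a b => ((↑) : Icc a b → ℝ) ⁻¹' V u)
    (fun u => (hVo u).preimage continuous_subtype_val)
    (fun u _ => mem_iUnion.2 ⟨u, hVm u⟩)
  have hstep : ∀ n, P (t n) (t (n + 1)) := by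
    intro n
    obtain ⟨u, hu⟩ := ht n
    have hle : t n ≤ t (n + 1) := htm (Nat.le_succ n)
    exact hV u _ (hu ⟨le_rfl, hle⟩) _ (hu ⟨hle, le_rfl⟩) (t n).2 (t (n + 1)).2 hle
  have hind : ∀ n, P (t 0) (t (n + 1)) := by
    intro n
    induction n with
    | zero => exact hstep 0
    | succ n ih =>
      exact hadd _ _ _ (t 0).2.1 (htm (Nat.zero_le _)) (htm (Nat.le_succ _)) (t _).2.2 ih
        (hstep (n + 1))
  have := hind m
  rwa [ht0, hm (m + 1) (Nat.le_succ m)] at this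

theorem integrableOn_clm_apply {X Y : Type*} [NormedAddCommGroup X] [NormedSpace ℝ X]
    [NormedAddCommGroup Y] [NormedSpace ℝ Y] {μ : Measure ℝ} {c : ℝ → X →L[ℝ] Y} {h : ℝ → X}
    {a b : ℝ} (hc : ContinuousOn c (Icc a b)) (hh : IntegrableOn h (Ioc a b) μ) :
    IntegrableOn (fun u => c u (h u)) (Ioc a b) μ := by
  obtain ⟨M, hM⟩ := isCompact_Icc.exists_bound_of_continuousOn hc
  refine Integrable.mono' (hh.norm.const_mul M) ?_ ?_
  · exact (ContinuousLinearMap.apply ℝ Y).flip.aestronglyMeasurable_comp₂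
      ((hc.mono Ioc_subset_Icc_self).aestronglyMeasurable measurableSet_Ioc) hh.aestronglyMeasurable
  · filter_upwards [ae_restrict_mem measurableSet_Ioc] with u hu
    exact (c u).le_of_opNorm_le (hM u (Ioc_subset_Icc_self hu)) _

/-- The chain rule for a continuous path that is an integral with respect to finitely many
measures. -/
theorem chain_rule {W : Type*} [NormedAddCommGroup W] [NormedSpace ℝ W] [CompleteSpace W]
    {ι : Type*} [Fintype ι] (μ : ι → Measure ℝ) {F : W → ℝ} (hF : ContDiff ℝ 1 F) {w : ℝ → W}
    {a b : ℝ} (hab : a ≤ b) (hw : ContinuousOn w (Icc a b)) (h : ι → ℝ → W)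
    (hh : ∀ i, IntegrableOn (h i) (Ioc a b) (μ i))
    (hwh : ∀ s t, a ≤ s → s ≤ t → t ≤ b → w t - w s = ∑ i, ∫ u in Ioc s t, h i u ∂μ i) :
    F (w b) - F (w a) = ∑ i, ∫ u in Ioc a b, fderiv ℝ F (w u) (h i u) ∂μ i := by
  have hF' : Continuous (fderiv ℝ F) := hF.continuous_fderiv one_ne_zero
  have hint : ∀ i, IntegrableOn (fun u => fderiv ℝ F (w u) (h i u)) (Ioc a b) (μ i) :=
    fun i => integrableOn_clm_apply (hF'.comp_continuousOn hw) (hh i)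
  have hmono : ∀ {s t : ℝ}, a ≤ s → t ≤ b → Ioc s t ⊆ Ioc a b := fun hs ht =>
    Ioc_subset_Ioc hs ht
  -- `M` is the driving mass and `D` the defect of the chain rule. Both are additive in the
  -- interval, so `|D| ≤ 2 ε M` need only be checked on short intervals.
  set M : ℝ → ℝ → ℝ := fun s t => ∑ i, ∫ u in Ioc s t, ‖h i u‖ ∂μ i with hM
  set D : ℝ → ℝ → ℝ := fun s t =>
    F (w t) - F (w s) - ∑ i, ∫ u in Ioc s t, fderiv ℝ F (w u) (h i u) ∂μ i with hD
  have hsplit : ∀ {G : ι → ℝ → ℝ}, (∀ i, IntegrableOn (G i) (Ioc a b) (μ i)) →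
      ∀ r s t, a ≤ r → r ≤ s → s ≤ t → t ≤ b →
      ∑ i, ∫ u in Ioc r t, G i u ∂μ i =
        ∑ i, ∫ u in Ioc r s, G i u ∂μ i + ∑ i, ∫ u in Ioc s t, G i u ∂μ i := by
    intro G hG r s t har hrs hst htb
    rw [← Finset.sum_add_distrib]
    refine Finset.sum_congr rfl fun i _ => ?_
    rw [← Ioc_union_Ioc_eq_Ioc hrs hst]
    refine setIntegral_union ?_ measurableSet_Ioc ((hG i).mono_set (hmono har (hst.trans htb)))
      ((hG i).mono_set (hmono (har.trans hrs) htb))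
    rw [Set.disjoint_left]
    intro u hu hu'
    exact absurd hu.2 (not_le.2 hu'.1)
  have key : ∀ ε > 0, |D a b| ≤ 2 * ε * M a b := by
    intro ε hε
    refine interval_induction (P := fun s t => |D s t| ≤ 2 * ε * M s t) hab ?_ ?_
    · intro r s t har hrs hst htb h1 h2
      have e1 : D r t = D r s + D s t := by
        simp only [hD]
        rw [hsplit hint r s t har hrs hst htb]
        ring
      have e2 : M r t = M r s + M s t := hsplit (fun i => (hh i).norm) r s t har hrs hst htb
      rw [e1, e2]
      calc |D r s + D s t| ≤ |D r s| + |D s t| := abs_add_le _ _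
        _ ≤ _ := by linarith
    · intro u hu
      have hstrict : HasStrictFDerivAt F (fderiv ℝ F (w u)) (w u) :=
        hF.contDiffAt.hasStrictFDerivAt one_ne_zero
      have hs1 : ∀ᶠ p in nhds (w u, w u),
          ‖F p.1 - F p.2 - fderiv ℝ F (w u) (p.1 - p.2)‖ ≤ ε * ‖p.1 - p.2‖ :=
        hstrict.isLittleO.bound hε
      have hs2 : ∀ᶠ y in nhds (w u), ‖fderiv ℝ F y - fderiv ℝ F (w u)‖ < ε := by
        have := (hF'.tendsto (w u)).eventually (Metric.ball_mem_nhds _ hε)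
        simpa [dist_eq_norm] using this
      obtain ⟨δ, hδ, hball⟩ := Metric.eventually_nhds_iff_ball.1 hs1
      obtain ⟨δ', hδ', hball'⟩ := Metric.eventually_nhds_iff_ball.1 hs2
      obtain ⟨η, hη, hηw⟩ := Metric.continuousWithinAt_iff.1 (hw u hu) (min δ δ')
        (lt_min hδ hδ')
      refine ⟨_, Metric.ball_mem_nhds u hη, fun s hsη t htη hs ht hst => ?_⟩
      have hb1 : ‖F (w t) - F (w s) - fderiv ℝ F (w u) (w t - w s)‖ ≤ ε * ‖w t - w s‖ := by
        refine hball (w t, w s) ?_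
        rw [Metric.mem_ball, Prod.dist_eq, max_lt_iff]
        exact ⟨(hηw ht htη).trans_le (min_le_left _ _), (hηw hs hsη).trans_le (min_le_left _ _)⟩
      have hb2 : ∀ v ∈ Ioc s t, ‖fderiv ℝ F (w v) - fderiv ℝ F (w u)‖ ≤ ε := by
        intro v hv
        refine (hball' _ ?_).le
        refine (hηw ⟨hs.1.trans hv.1.le, hv.2.trans ht.2⟩ ?_).trans_le (min_le_right _ _)
        rw [Metric.mem_ball, Real.dist_eq, abs_lt] at *
        constructor <;> linarith [hv.1, hv.2, hsη.1, htη.2]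
      have hsub := hmono hs.1 ht.2
      have hwn : ‖w t - w s‖ ≤ M s t := by
        rw [hwh s t hs.1 hst ht.2]
        exact (norm_sum_le _ _).trans (Finset.sum_le_sum fun i _ => norm_integral_le_integral_norm _)
      have hlin : fderiv ℝ F (w u) (w t - w s) =
          ∑ i, ∫ v in Ioc s t, fderiv ℝ F (w u) (h i v) ∂μ i := by
        rw [hwh s t hs.1 hst ht.2, map_sum]
        refine Finset.sum_congr rfl fun i _ => ?_
        exact ((fderiv ℝ F (w u)).integral_comp_comm ((hh i).mono_set hsub)).symm
      -- One `ε` is the linearization error `hb1` of `F` at `w u`; this is the other, from freezing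
      -- the derivative at `w u`.
      have hdiff : |fderiv ℝ F (w u) (w t - w s) -
          ∑ i, ∫ v in Ioc s t, fderiv ℝ F (w v) (h i v) ∂μ i| ≤ ε * M s t := by
        rw [hlin, ← Finset.sum_sub_distrib, hM, Finset.mul_sum]
        refine (Finset.abs_sum_le_sum_abs _ _).trans (Finset.sum_le_sum fun i _ => ?_)
        have hi1 : IntegrableOn (fun v => fderiv ℝ F (w u) (h i v)) (Ioc s t) (μ i) :=
          (fderiv ℝ F (w u)).integrable_comp ((hh i).mono_set hsub)
        rw [← integral_sub hi1 ((hint i).mono_set hsub), ← integral_const_mul, ← Real.norm_eq_abs]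
        refine norm_integral_le_of_norm_le (((hh i).mono_set hsub).norm.const_mul ε) ?_
        filter_upwards [ae_restrict_mem measurableSet_Ioc] with v hv
        rw [← sub_apply]
        refine ContinuousLinearMap.le_of_opNorm_le _ ?_ _
        rw [norm_sub_rev]
        exact hb2 v hv
      have hsum : D s t = (F (w t) - F (w s) - fderiv ℝ F (w u) (w t - w s)) +
          (fderiv ℝ F (w u) (w t - w s) -
            ∑ i, ∫ v in Ioc s t, fderiv ℝ F (w v) (h i v) ∂μ i) := by
        simp only [hD]; ring
      rw [hsum]
      refine (abs_add_le _ _).trans ?_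
      rw [Real.norm_eq_abs] at hb1
      have := mul_le_mul_of_nonneg_left hwn hε.le
      linarith
  have hM0 : 0 ≤ M a b := Finset.sum_nonneg fun i _ => integral_nonneg fun _ => norm_nonneg _
  have hD0 : |D a b| ≤ 0 := by
    refine le_of_forall_pos_le_add fun η hη => ?_
    have := key (η / (2 * (M a b + 1))) (by positivity)
    refine this.trans ?_
    rw [zero_add]
    have e : 2 * (η / (2 * (M a b + 1))) * M a b = η * (M a b / (M a b + 1)) := by
      field_simp
    rw [e]
    exact mul_le_of_le_one_right hη.le ((div_le_one (by linarith)).2 (by linarith))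
  have := abs_nonpos_iff.1 hD0
  exact sub_eq_zero.1 this

end ReflectedSkeleton

/-! ### The reflection measure and the Lyapunov function. -/

namespace ReflectedSkeleton

variable {E : Type*} [NormedAddCommGroup E] [InnerProductSpace ℝ E]

/-- The mass is the right limit at `1` minus the left limit at `0` of the extended variation, which
is constant after `1` and nonnegative. An inequality suffices later, so continuity of the variation
is not needed. -/
theorem variationMeasure_Icc_le [CompleteSpace E] (k : ℝ → E) (hk : BoundedVariationOn k (Icc 0 1)) :
    variationMeasure k hk (Icc 0 1) ≤ ENNReal.ofReal (totalVariation k 1) := by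
  have hm := monotone_totalVariation hk
  rw [variationMeasure, StieltjesFunction.measure_Icc]
  apply ENNReal.ofReal_le_ofReal
  have h1 : hm.stieltjesFunction 1 ≤ totalVariation k 1 := by
    rw [Monotone.stieltjesFunction_eq]
    refine le_of_tendsto (hm.tendsto_rightLim 1) ?_
    filter_upwards [self_mem_nhdsWithin] with t ht
    simp [totalVariation, min_eq_right (le_of_lt (show (1 : ℝ) < t from ht))]
  have h2 : 0 ≤ Function.leftLim hm.stieltjesFunction 0 := by
    refine le_trans ?_ (hm.stieltjesFunction.mono.le_leftLim (show (-1 : ℝ) < 0 by norm_num))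
    rw [Monotone.stieltjesFunction_eq]
    exact (ENNReal.toReal_nonneg).trans (hm.le_rightLim le_rfl)
  linarith

/-- The reflection term of a solution is an integral of outward normals with respect to a measure
that is carried by the times at which the solution is on the boundary. -/
theorem IsSkeletonSolution.exists_reflection_measure [CompleteSpace E] {O : Set E} {b : E → E}
    {σ : E → E →L[ℝ] E} {x : E} {ψ z k : ℝ → E} (h : IsSkeletonSolution O b σ x ψ z k) :
    ∃ (μ : Measure ℝ) (ξ : E → E), (∀ y ∈ frontier O, ξ y ∈ outwardNormals O y) ∧
      IntegrableOn (fun s => ξ (z s)) (Ioc 0 1) μ ∧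
      (∀ s t, 0 ≤ s → s ≤ t → t ≤ 1 → k t - k s = ∫ u in Ioc s t, ξ (z u) ∂μ) ∧
      ∀ᵐ u ∂μ.restrict (Ioc 0 1), z u ∈ frontier O := by
  obtain ⟨hk, ⟨ξ, hξ, hint, hkξ⟩, hV⟩ := h.reflection
  refine ⟨variationMeasure k hk, ξ, hξ, hint.mono_set Ioc_subset_Icc_self, ?_, ?_⟩
  · intro s t hs hst ht
    rw [hkξ t ⟨hs.trans hst, ht⟩, hkξ s ⟨hs, hst.trans ht⟩,
      ← Icc_union_Ioc_eq_Icc hs hst, setIntegral_union ?_ measurableSet_Ioc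
        (hint.mono_set (Icc_subset_Icc_right (hst.trans ht)))
        (hint.mono_set fun u hu => ⟨hs.trans hu.1.le, hu.2.trans ht⟩), add_sub_cancel_left]
    rw [Set.disjoint_left]
    intro u hu hu'
    exact absurd hu.2 (not_le.2 hu'.1)
  · set μ := variationMeasure k hk
    set Z := Icc (0 : ℝ) 1 ∩ z ⁻¹' frontier O with hZ
    have hZm : MeasurableSet Z :=
      (h.continuousOn_z.preimage_isClosed_of_isClosed isClosed_Icc isClosed_frontier).measurableSet
    -- The support condition at time `1` places the mass `|k|_1` on `Z`; as `[0, 1]` has no more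
    -- mass than that, the rest of it is null.
    have h1 : ENNReal.ofReal (totalVariation k 1) = μ Z := by
      rw [hV 1 ⟨zero_le_one, le_rfl⟩, ← lintegral_indicator measurableSet_Icc,
        ← lintegral_indicator_one hZm]
      congr 1
      ext s
      by_cases hs : s ∈ Icc (0 : ℝ) 1 <;> by_cases hs' : z s ∈ frontier O <;>
        simp [hZ, indicator, hs, hs']
    have h2 : μ (Icc 0 1) ≤ μ Z := (variationMeasure_Icc_le k hk).trans h1.le
    have hfin : μ Z ≠ ∞ := h1 ▸ ENNReal.ofReal_ne_top
    have h3 : μ (Icc 0 1 \ Z) = 0 := by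
      rw [measure_sdiff inter_subset_left hZm.nullMeasurableSet hfin]
      exact tsub_eq_zero_of_le h2
    have h4 : ∀ᵐ u ∂μ, u ∉ Icc 0 1 \ Z := measure_eq_zero_iff_ae_notMem.1 h3
    rw [ae_restrict_iff' measurableSet_Ioc]
    filter_upwards [h4] with u hu hu'
    by_contra hc
    exact hu ⟨Ioc_subset_Icc_self hu', fun hz => hc hz.2⟩

theorem IsSkeletonSolution.initial [CompleteSpace E] {O : Set E} {b : E → E}
    {σ : E → E →L[ℝ] E} {x : E} {ψ z k : ℝ → E} (h : IsSkeletonSolution O b σ x ψ z k) :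
    z 0 = x := by
  simpa [h.k_zero] using h.equation 0 ⟨le_rfl, zero_le_one⟩

theorem integrableOn_drift {b : E → E} {σ : E → E →L[ℝ] E} (hb : Continuous b)
    (hσ : Continuous σ) {z ψ : ℝ → E} {s t : ℝ} (hz : ContinuousOn z (Icc s t))
    (hψ : IntegrableOn ψ (Ioc s t)) :
    IntegrableOn (fun u => b (z u)) (Ioc s t) ∧
      IntegrableOn (fun u => σ (z u) (ψ u)) (Ioc s t) :=
  ⟨((hb.comp_continuousOn hz).integrableOn_Icc).mono_set Ioc_subset_Icc_self,
    integrableOn_clm_apply (hσ.comp_continuousOn hz) hψ⟩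

theorem IsSkeletonSolution.increment [CompleteSpace E] {O : Set E} {b : E → E}
    {σ : E → E →L[ℝ] E} {x : E} {ψ z k : ℝ → E} (h : IsSkeletonSolution O b σ x ψ z k)
    (hb : Continuous b) (hσ : Continuous σ) (hψ : IntegrableOn ψ (Ioc 0 1)) {s t : ℝ}
    (hs : 0 ≤ s) (hst : s ≤ t) (ht : t ≤ 1) :
    z t - z s = (∫ u in Ioc s t, (b (z u) + σ (z u) (ψ u))) - (k t - k s) := by
  obtain ⟨i1, i2⟩ := integrableOn_drift hb hσ h.continuousOn_z hψ
  have hii : ∀ {g : ℝ → E}, IntegrableOn g (Ioc 0 1) → ∀ {p q : ℝ}, 0 ≤ p → p ≤ q → q ≤ 1 →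
      IntervalIntegrable g volume p q := fun hg p q hp hpq hq =>
    (intervalIntegrable_iff_integrableOn_Ioc_of_le hpq).2 (hg.mono_set (Ioc_subset_Ioc hp hq))
  have hs1 := hst.trans ht
  rw [integral_add (i1.mono_set (Ioc_subset_Ioc hs ht)) (i2.mono_set (Ioc_subset_Ioc hs ht)),
    h.equation t ⟨hs.trans hst, ht⟩, h.equation s ⟨hs, hs1⟩,
    ← intervalIntegral.integral_of_le hst, ← intervalIntegral.integral_of_le hst,
    ← intervalIntegral.integral_add_adjacent_intervals (hii i1 le_rfl hs hs1) (hii i1 hs hst ht),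
    ← intervalIntegral.integral_add_adjacent_intervals (hii i2 le_rfl hs hs1) (hii i2 hs hst ht)]
  abel

/-- The weighted squared distance of two paths, the Lyapunov function of the stability estimate. -/
def weightedSqDist (φ : E → ℝ) (l : ℝ) (p : E × E × ℝ) : ℝ :=
  Real.exp (-(l * (φ p.1 + φ p.2.1) + p.2.2)) * ‖p.1 - p.2.1‖ ^ 2

theorem contDiff_weightedSqDist {φ : E → ℝ} (hφ : ContDiff ℝ 1 φ) (l : ℝ) :
    ContDiff ℝ 1 (weightedSqDist φ l) := by
  unfold weightedSqDist
  refine ContDiff.mul (Real.contDiff_exp.comp ?_) (ContDiff.norm_sq ℝ (by fun_prop))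
  exact ((contDiff_const.mul ((hφ.comp contDiff_fst).add
    (hφ.comp (contDiff_fst.comp contDiff_snd)))).add (contDiff_snd.comp contDiff_snd)).neg

theorem fderiv_weightedSqDist_apply {φ : E → ℝ} (hφ : ContDiff ℝ 1 φ) (l : ℝ) (p v : E × E × ℝ) :
    fderiv ℝ (weightedSqDist φ l) p v =
      Real.exp (-(l * (φ p.1 + φ p.2.1) + p.2.2)) *
        (2 * inner ℝ (p.1 - p.2.1) (v.1 - v.2.1) -
          (l * (fderiv ℝ φ p.1 v.1 + fderiv ℝ φ p.2.1 v.2.1) + v.2.2) * ‖p.1 - p.2.1‖ ^ 2) := by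
  have hline : HasDerivAt (fun t : ℝ => p + t • v) v 0 := by
    simpa using ((hasDerivAt_id (0 : ℝ)).smul_const v).const_add p
  have h1 : HasDerivAt (fun t : ℝ => weightedSqDist φ l (p + t • v))
      (fderiv ℝ (weightedSqDist φ l) p v) 0 := by
    have : HasFDerivAt (weightedSqDist φ l) (fderiv ℝ (weightedSqDist φ l) p)
        (p + (0 : ℝ) • v) := by
      simpa using ((contDiff_weightedSqDist hφ l).differentiable one_ne_zero p).hasFDerivAt
    exact this.comp_hasDerivAt (0 : ℝ) hline
  have hφd : ∀ q u : E, HasDerivAt (fun t : ℝ => φ (q + t • u)) (fderiv ℝ φ q u) 0 := by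
    intro q u
    have hl : HasDerivAt (fun t : ℝ => q + t • u) u 0 := by
      simpa using ((hasDerivAt_id (0 : ℝ)).smul_const u).const_add q
    have : HasFDerivAt φ (fderiv ℝ φ q) (q + (0 : ℝ) • u) := by
      simpa using (hφ.differentiable one_ne_zero q).hasFDerivAt
    exact this.comp_hasDerivAt (0 : ℝ) hl
  have hd : HasDerivAt (fun t : ℝ => (p.1 + t • v.1) - (p.2.1 + t • v.2.1)) (v.1 - v.2.1) 0 := by
    have e1 := ((hasDerivAt_id (0 : ℝ)).smul_const v.1).const_add p.1
    have e2 := ((hasDerivAt_id (0 : ℝ)).smul_const v.2.1).const_add p.2.1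
    simpa using e1.fun_sub e2
  have ha : HasDerivAt (fun t : ℝ => p.2.2 + t * v.2.2) v.2.2 0 := by
    simpa using ((hasDerivAt_id (0 : ℝ)).mul_const v.2.2).const_add p.2.2
  have h2 := ((((((hφd p.1 v.1).add (hφd p.2.1 v.2.1)).const_mul l).add ha).neg).exp).mul hd.norm_sq
  refine h1.unique (h2.congr_deriv ?_)
  simp
  ring

/-- The drift of the weighted squared distance. -/
theorem drift_bound {l M S B K K' d p₁ p₂ q x₁ x₂ g₁ g₂ u : ℝ} (hl : 0 ≤ l) (hp₂ : 0 ≤ p₂)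
    (hM : 0 ≤ M) (hK' : 0 ≤ K')
    (hx₁ : x₁ ≤ B + S * p₁) (hx₂ : x₂ ≤ B + S * p₂)
    (hg₁ : |g₁| ≤ M * x₁) (hg₂ : |g₂| ≤ M * x₂)
    (hu : u ≤ d * (K * d + K' * d * p₁ + S * q)) :
    2 * u - (l * (g₁ + g₂) + ((2 * K + 1 + 2 * l * M * B) +
      (2 * K' + l * M * S) * (p₁ + p₂))) * d ^ 2 ≤ S ^ 2 * q ^ 2 := by
  have h1 : -(g₁ + g₂) ≤ M * (2 * B + S * (p₁ + p₂)) := by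
    have a1 := neg_abs_le g₁
    have a2 := neg_abs_le g₂
    have a3 := mul_le_mul_of_nonneg_left hx₁ hM
    have a4 := mul_le_mul_of_nonneg_left hx₂ hM
    linarith
  have h2 : -(g₁ + g₂) * (l * d ^ 2) ≤ M * (2 * B + S * (p₁ + p₂)) * (l * d ^ 2) := by gcongr
  -- Young's inequality; its `d ^ 2` is paid for by the `1` in `2 * K + 1`.
  have h3 : 2 * (d * (S * q)) ≤ d ^ 2 + S ^ 2 * q ^ 2 := by nlinarith [sq_nonneg (d - S * q)]
  -- The Lipschitz error involves `p₁` only, while the weight is symmetric; this surplus is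
  -- discarded.
  have h4 : 0 ≤ K' * p₂ * d ^ 2 := by positivity
  nlinarith

theorem abs_le_and_norm_fderiv_le {φ : E → ℝ} {M : ℝ}
    (hM : ∀ i : ℕ, i ≤ 2 → ∀ x, ‖iteratedFDeriv ℝ i φ x‖ ≤ M) (x : E) :
    |φ x| ≤ M ∧ ‖fderiv ℝ φ x‖ ≤ M := by
  constructor
  · simpa using hM 0 (by norm_num) x
  · simpa [norm_iteratedFDeriv_one] using hM 1 (by norm_num) x

/-- This is the cancellation behind the choice `l = 2 / α`: condition 1 bounds the first term by `2
C₀ |x - y|²`, condition 3 the second by `-2 C₀ |x - y|²`. -/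
theorem reflection_drift_nonpos [CompleteSpace E] {O : Set E} {C₀ α : ℝ} (hα : 0 < α)
    (hineq : NormalInequality O C₀) {φ : E → ℝ}
    (hφn : ∀ x ∈ frontier O, ∀ ζ ∈ outwardNormals O x, inner ℝ (gradient φ x) ζ ≤ -α * C₀)
    {x y ν : E} (hx : x ∈ frontier O) (hy : y ∈ closure O) (hν : ν ∈ outwardNormals O x) :
    -(2 * inner ℝ (x - y) ν) + 2 / α * fderiv ℝ φ x ν * ‖x - y‖ ^ 2 ≤ 0 := by
  have h1 := hineq x hx y hy ν hν
  have h2 := hφn x hx ν hν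
  have h3 : inner ℝ (gradient φ x) ν = fderiv ℝ φ x ν := by
    rw [gradient, InnerProductSpace.toDual_symm_apply]
  rw [h3] at h2
  have h4 : 2 / α * fderiv ℝ φ x ν * ‖x - y‖ ^ 2 ≤ 2 / α * (-α * C₀) * ‖x - y‖ ^ 2 := by gcongr
  have h5 : 2 / α * (-α * C₀) = -2 * C₀ := by field_simp
  rw [h5] at h4
  linarith

end ReflectedSkeleton

/-! ### Stability with respect to the control. -/

namespace ReflectedSkeleton

variable {E : Type*} [NormedAddCommGroup E]

theorem integrableOn_of_memLp_two {ψ : ℝ → E} (hψ : MemLp ψ 2 (volume.restrict (Icc 0 1))) :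
    IntegrableOn ψ (Ioc 0 1) ∧ IntegrableOn (fun s => ‖ψ s‖ ^ 2) (Ioc 0 1) := by
  have h2 : IntegrableOn (fun s => ‖ψ s‖ ^ 2) (Icc 0 1) :=
    (memLp_two_iff_integrable_sq_norm hψ.1).1 hψ
  have h1 : IntegrableOn ψ (Icc 0 1) := hψ.integrable (by norm_num)
  exact ⟨h1.mono_set Ioc_subset_Icc_self, h2.mono_set Ioc_subset_Icc_self⟩

theorem integral_norm_le_of_sq {ψ : ℝ → E} (hψ : MemLp ψ 2 (volume.restrict (Icc 0 1))) {r : ℝ}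
    (hr : ∫ s in (0 : ℝ)..1, ‖ψ s‖ ^ 2 ≤ r) : ∫ s in Ioc (0 : ℝ) 1, ‖ψ s‖ ≤ 1 + r := by
  obtain ⟨h1, h2⟩ := integrableOn_of_memLp_two hψ
  rw [intervalIntegral.integral_of_le zero_le_one] at hr
  have hc : IntegrableOn (fun _ : ℝ => (1 : ℝ)) (Ioc 0 1) := by simp
  have : ∫ s in Ioc (0 : ℝ) 1, ‖ψ s‖ ≤ ∫ s in Ioc (0 : ℝ) 1, (1 + ‖ψ s‖ ^ 2) :=
    integral_mono h1.norm (hc.add h2) fun s => by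
      dsimp only
      nlinarith [sq_nonneg (‖ψ s‖ - 1), norm_nonneg (ψ s)]
  rw [integral_add hc h2] at this
  simp only [integral_const, MeasurableSet.univ, measureReal_restrict_apply, univ_inter,
    Real.volume_real_Ioc, sub_zero, smul_eq_mul, mul_one] at this
  norm_num at this
  linarith

/-- The reflection terms lower the weighted squared distance, so its growth is at most the integral
of the remaining drift; unwinding the weights gives the constant. -/
theorem stability [InnerProductSpace ℝ E] [CompleteSpace E] {O : Set E} {C₀ α : ℝ} (hα : 0 < α) (hineq : NormalInequality O C₀)
    {φ : E → ℝ} (hφ : IsCb2 φ)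
    (hφn : ∀ x ∈ frontier O, ∀ ζ ∈ outwardNormals O x, inner ℝ (gradient φ x) ζ ≤ -α * C₀)
    {b : E → E} {σ : E → E →L[ℝ] E}
    (hb_bdd : ∃ M : ℝ, ∀ x, ‖b x‖ ≤ M) (hb_lip : ∃ K, LipschitzWith K b)
    (hσ_bdd : ∃ M : ℝ, ∀ x, ‖σ x‖ ≤ M) (hσ_lip : ∃ K, LipschitzWith K σ) (r : ℝ) :
    ∃ c : ℝ, 0 < c ∧ ∀ x, ∀ ψ₁ ψ₂ : ℝ → E,
      MemLp ψ₁ 2 (volume.restrict (Icc 0 1)) → MemLp ψ₂ 2 (volume.restrict (Icc 0 1)) →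
      ∫ s in (0 : ℝ)..1, ‖ψ₁ s‖ ^ 2 ≤ r → ∫ s in (0 : ℝ)..1, ‖ψ₂ s‖ ^ 2 ≤ r →
      ∀ z₁ k₁ z₂ k₂, IsSkeletonSolution O b σ x ψ₁ z₁ k₁ →
        IsSkeletonSolution O b σ x ψ₂ z₂ k₂ →
        ∀ t ∈ Icc (0 : ℝ) 1,
          ‖z₁ t - z₂ t‖ ^ 2 ≤ c * ∫ s in Ioc 0 t, ‖ψ₁ s - ψ₂ s‖ ^ 2 := by
  obtain ⟨B, hB⟩ := hb_bdd
  obtain ⟨K, hK⟩ := hb_lip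
  obtain ⟨S, hS⟩ := hσ_bdd
  obtain ⟨K', hK'⟩ := hσ_lip
  obtain ⟨hφ2, M, hM⟩ := hφ
  have hφ1 : ContDiff ℝ 1 φ := hφ2.of_le (by norm_num)
  have hM0 : 0 ≤ M := (abs_nonneg _).trans (abs_le_and_norm_fderiv_le hM 0).1
  have hB0 : 0 ≤ B := (norm_nonneg _).trans (hB 0)
  have hS0 : 0 ≤ S := (norm_nonneg _).trans (hS 0)
  set l : ℝ := 2 / α with hl
  have hl0 : 0 ≤ l := by positivity
  set A₀ : ℝ := 2 * K + 1 + 2 * l * M * B with hA₀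
  set A₁ : ℝ := 2 * K' + l * M * S with hA₁
  have hA₀0 : 0 ≤ A₀ := by positivity
  have hA₁0 : 0 ≤ A₁ := by positivity
  -- Bounds the integral of the rate `a`, each control contributing at most `1 + r` to the `L¹`
  -- part.
  set R : ℝ := A₀ + A₁ * (2 * (1 + r)) with hR
  -- The exponent combines the lower bound `exp(-(2 l M + R))` and the upper bound `exp(2 l M)` of
  -- the weight; the `+ 1` keeps the constant positive when `S = 0`.
  refine ⟨Real.exp (4 * l * M + R) * (S ^ 2 + 1), by positivity, ?_⟩
  intro x ψ₁ ψ₂ hψ₁ hψ₂ hr₁ hr₂ z₁ k₁ z₂ k₂ hz₁ hz₂ t ht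
  obtain ⟨μ₁, ξ₁, hξ₁, hi₁, hk₁, ha₁⟩ := hz₁.exists_reflection_measure
  obtain ⟨μ₂, ξ₂, hξ₂, hi₂, hk₂, ha₂⟩ := hz₂.exists_reflection_measure
  have hψ₁i := (integrableOn_of_memLp_two hψ₁).1
  have hψ₂i := (integrableOn_of_memLp_two hψ₂).1
  have hψd : IntegrableOn (fun s => ‖ψ₁ s - ψ₂ s‖ ^ 2) (Ioc 0 1) :=
    (integrableOn_of_memLp_two (hψ₁.sub hψ₂)).2
  set a : ℝ → ℝ := fun s => A₀ + A₁ * (‖ψ₁ s‖ + ‖ψ₂ s‖) with ha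
  have ha0 : ∀ s, 0 ≤ a s := fun s => by positivity
  have hai : IntegrableOn a (Ioc 0 1) := by
    have hc : IntegrableOn (fun _ : ℝ => A₀) (Ioc 0 1) := by simp
    exact hc.add ((hψ₁i.norm.add hψ₂i.norm).const_mul A₁)
  have haR : ∫ s in Ioc (0 : ℝ) 1, a s ≤ R := by
    have hc : IntegrableOn (fun _ : ℝ => A₀) (Ioc 0 1) := by simp
    have e : ∫ s in Ioc (0 : ℝ) 1, a s = A₀ + A₁ * ((∫ s in Ioc (0 : ℝ) 1, ‖ψ₁ s‖) +
        ∫ s in Ioc (0 : ℝ) 1, ‖ψ₂ s‖) := by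
      have hs : IntegrableOn (fun s => A₁ * (‖ψ₁ s‖ + ‖ψ₂ s‖)) (Ioc 0 1) :=
        (hψ₁i.norm.add hψ₂i.norm).const_mul A₁
      rw [← integral_add hψ₁i.norm hψ₂i.norm, ← integral_const_mul, integral_add hc hs]
      simp
    rw [e]
    have := integral_norm_le_of_sq hψ₁ hr₁
    have := integral_norm_le_of_sq hψ₂ hr₂
    have : A₁ * ((∫ s in Ioc (0 : ℝ) 1, ‖ψ₁ s‖) + ∫ s in Ioc (0 : ℝ) 1, ‖ψ₂ s‖) ≤
        A₁ * (2 * (1 + r)) := by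
      gcongr
      linarith
    linarith
  set A : ℝ → ℝ := fun s => ∫ u in Ioc 0 s, a u with hA
  have hAle : ∀ s ∈ Icc (0 : ℝ) 1, 0 ≤ A s ∧ A s ≤ R := fun s hs =>
    ⟨integral_nonneg ha0, (setIntegral_mono_set hai (Filter.Eventually.of_forall ha0)
      (Ioc_subset_Ioc_right hs.2).eventuallyLE).trans haR⟩
  have hAc : ContinuousOn A (Icc 0 1) := by
    have := intervalIntegral.continuousOn_primitive_Icc (μ := volume) (a := 0) (b := 1) (f := a)
      ((integrableOn_Icc_iff_integrableOn_Ioc).2 hai)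
    refine this.congr fun s hs => ?_
    simp only [hA]
    rw [integral_Icc_eq_integral_Ioc]
  obtain ⟨id1, ie1⟩ := integrableOn_drift hK.continuous hK'.continuous hz₁.continuousOn_z hψ₁i
  obtain ⟨id2, ie2⟩ := integrableOn_drift hK.continuous hK'.continuous hz₂.continuousOn_z hψ₂i
  set f₁ : ℝ → E := fun u => b (z₁ u) + σ (z₁ u) (ψ₁ u) with hf₁
  set f₂ : ℝ → E := fun u => b (z₂ u) + σ (z₂ u) (ψ₂ u) with hf₂
  have hf₁i : IntegrableOn f₁ (Ioc 0 1) := id1.add ie1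
  have hf₂i : IntegrableOn f₂ (Ioc 0 1) := id2.add ie2
  set w : ℝ → E × E × ℝ := fun s => (z₁ s, z₂ s, A s) with hw
  have hwc : ContinuousOn w (Icc 0 t) :=
    (hz₁.continuousOn_z.prodMk (hz₂.continuousOn_z.prodMk hAc)).mono (Icc_subset_Icc_right ht.2)
  -- The path `(z₁, z₂, A)` is driven by Lebesgue measure and the two reflection measures, each
  -- reflection moving its own component along the inward normal.
  set μ : Fin 3 → Measure ℝ := ![volume, μ₁, μ₂] with hμ
  set h : Fin 3 → ℝ → E × E × ℝ := ![fun u => (f₁ u, f₂ u, a u),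
    fun u => (-ξ₁ (z₁ u), 0, 0), fun u => (0, -ξ₂ (z₂ u), 0)] with hh
  have hI0 : IntegrableOn (fun u => (f₁ u, f₂ u, a u)) (Ioc 0 1) :=
    Integrable.prodMk hf₁i (Integrable.prodMk hf₂i hai)
  have hI1 : IntegrableOn (fun u => ((-ξ₁ (z₁ u), 0, 0) : E × E × ℝ)) (Ioc 0 1) μ₁ :=
    Integrable.prodMk hi₁.neg (integrable_zero _ _ _)
  have hI2 : IntegrableOn (fun u => ((0, -ξ₂ (z₂ u), 0) : E × E × ℝ)) (Ioc 0 1) μ₂ :=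
    Integrable.prodMk (integrable_zero _ _ _) (Integrable.prodMk hi₂.neg (integrable_zero _ _ _))
  have hhi : ∀ i, IntegrableOn (h i) (Ioc 0 t) (μ i) := by
    have hs : Ioc (0 : ℝ) t ⊆ Ioc 0 1 := Ioc_subset_Ioc_right ht.2
    intro i
    fin_cases i
    · exact hI0.mono_set hs
    · exact hI1.mono_set hs
    · exact hI2.mono_set hs
  have hwh : ∀ p q, 0 ≤ p → p ≤ q → q ≤ t →
      w q - w p = ∑ i, ∫ u in Ioc p q, h i u ∂μ i := by
    intro p q hp hpq hq
    have hq1 := hq.trans ht.2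
    have hs : Ioc p q ⊆ Ioc 0 1 := Ioc_subset_Ioc hp hq1
    have hA' : A q - A p = ∫ u in Ioc p q, a u := by
      simp only [hA]
      rw [← Ioc_union_Ioc_eq_Ioc hp hpq, setIntegral_union _ measurableSet_Ioc
        (hai.mono_set (Ioc_subset_Ioc_right (hpq.trans hq1))) (hai.mono_set hs),
        add_sub_cancel_left]
      rw [Set.disjoint_left]
      intro u hu hu'
      exact absurd hu.2 (not_le.2 hu'.1)
    have e0 : ∫ u in Ioc p q, (f₁ u, f₂ u, a u) =
        (∫ u in Ioc p q, f₁ u, ∫ u in Ioc p q, f₂ u, ∫ u in Ioc p q, a u) := by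
      rw [integral_pair (hf₁i.mono_set hs)
        (Integrable.prodMk (hf₂i.mono_set hs) (hai.mono_set hs)),
        integral_pair (hf₂i.mono_set hs) (hai.mono_set hs)]
    have hn₁ : Integrable (fun u => -ξ₁ (z₁ u)) (μ₁.restrict (Ioc p q)) := (hi₁.mono_set hs).neg
    have hn₂ : Integrable (fun u => -ξ₂ (z₂ u)) (μ₂.restrict (Ioc p q)) := (hi₂.mono_set hs).neg
    have e1 : ∫ u in Ioc p q, ((-ξ₁ (z₁ u), 0, 0) : E × E × ℝ) ∂μ₁ =
        (-∫ u in Ioc p q, ξ₁ (z₁ u) ∂μ₁, 0, 0) := by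
      rw [integral_pair (g := fun _ => ((0, 0) : E × ℝ)) hn₁ (integrable_zero _ _ _), integral_neg]
      congr 1
      exact integral_zero _ _
    have e2 : ∫ u in Ioc p q, ((0, -ξ₂ (z₂ u), 0) : E × E × ℝ) ∂μ₂ =
        (0, -∫ u in Ioc p q, ξ₂ (z₂ u) ∂μ₂, 0) := by
      rw [integral_pair (f := fun _ => (0 : E)) (integrable_zero _ _ _)
        (hn₂.prodMk (integrable_zero _ _ _)),
        integral_pair (g := fun _ => (0 : ℝ)) hn₂ (integrable_zero _ _ _), integral_neg,
        integral_zero, integral_zero]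
    rw [Fin.sum_univ_three]
    simp only [hh, hμ, Matrix.cons_val_zero, Matrix.cons_val_one, Matrix.cons_val]
    rw [e0, e1, e2, ← hk₁ p q hp hpq hq1, ← hk₂ p q hp hpq hq1, ← hA']
    simp only [hw, Prod.mk_sub_mk, Prod.mk_add_mk,
      hz₁.increment hK.continuous hK'.continuous hψ₁i hp hpq hq1,
      hz₂.increment hK.continuous hK'.continuous hψ₂i hp hpq hq1]
    refine Prod.ext ?_ (Prod.ext ?_ ?_) <;> simp [hf₁, hf₂, sub_eq_add_neg]
  have hchain := chain_rule μ (contDiff_weightedSqDist hφ1 l) ht.1 hwc h hhi hwh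
  rw [Fin.sum_univ_three] at hchain
  simp only [hh, hμ, Matrix.cons_val_zero, Matrix.cons_val_one, Matrix.cons_val] at hchain
  have hst : Ioc (0 : ℝ) t ⊆ Ioc 0 1 := Ioc_subset_Ioc_right ht.2
  have hw0 : weightedSqDist φ l (w 0) = 0 := by
    simp [weightedSqDist, hw, hz₁.initial, hz₂.initial]
  have hφabs : ∀ y y', -(2 * M) ≤ φ y + φ y' ∧ φ y + φ y' ≤ 2 * M := by
    intro y y'
    have h1 := abs_le.1 (abs_le_and_norm_fderiv_le hM y).1
    have h2 := abs_le.1 (abs_le_and_norm_fderiv_le hM y').1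
    constructor <;> linarith
  have hJ1 : ∫ u in Ioc 0 t, fderiv ℝ (weightedSqDist φ l) (w u) (-ξ₁ (z₁ u), 0, 0) ∂μ₁ ≤ 0 := by
    refine integral_nonpos_of_ae ?_
    filter_upwards [ae_mono (Measure.restrict_mono_set μ₁ hst) ha₁,
      ae_restrict_mem measurableSet_Ioc] with u hu hu'
    have hu1 : u ∈ Icc (0 : ℝ) 1 := Ioc_subset_Icc_self (hst hu')
    have := reflection_drift_nonpos hα hineq hφn hu (hz₂.mem_closure u hu1) (hξ₁ _ hu)
    rw [fderiv_weightedSqDist_apply hφ1]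
    refine mul_nonpos_of_nonneg_of_nonpos (Real.exp_pos _).le ?_
    simp only [hw, sub_zero, map_neg, map_zero, add_zero, inner_neg_right]
    rw [← hl] at this
    linarith
  have hJ2 : ∫ u in Ioc 0 t, fderiv ℝ (weightedSqDist φ l) (w u) (0, -ξ₂ (z₂ u), 0) ∂μ₂ ≤ 0 := by
    refine integral_nonpos_of_ae ?_
    filter_upwards [ae_mono (Measure.restrict_mono_set μ₂ hst) ha₂,
      ae_restrict_mem measurableSet_Ioc] with u hu hu'
    have hu1 : u ∈ Icc (0 : ℝ) 1 := Ioc_subset_Icc_self (hst hu')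
    have := reflection_drift_nonpos hα hineq hφn hu (hz₁.mem_closure u hu1) (hξ₂ _ hu)
    rw [fderiv_weightedSqDist_apply hφ1]
    refine mul_nonpos_of_nonneg_of_nonpos (Real.exp_pos _).le ?_
    simp only [hw, zero_sub, map_neg, map_zero, zero_add, add_zero, neg_neg]
    rw [← hl, norm_sub_rev, ← neg_sub (z₁ u), inner_neg_left] at this
    linarith
  have hJ0 : ∫ u in Ioc 0 t, fderiv ℝ (weightedSqDist φ l) (w u) (f₁ u, f₂ u, a u) ≤
      ∫ u in Ioc 0 t, Real.exp (2 * l * M) * (S ^ 2 * ‖ψ₁ u - ψ₂ u‖ ^ 2) := by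
    refine setIntegral_mono_on ?_ (((hψd.mono_set hst).const_mul _).const_mul _)
      measurableSet_Ioc ?_
    · exact integrableOn_clm_apply
        (((contDiff_weightedSqDist hφ1 l).continuous_fderiv one_ne_zero).comp_continuousOn hwc)
        (hI0.mono_set hst)
    · intro u hu
      have hu1 : u ∈ Icc (0 : ℝ) 1 := Ioc_subset_Icc_self (hst hu)
      rw [fderiv_weightedSqDist_apply hφ1]
      simp only [hw]
      have hfn : ∀ y p, ‖b y + σ y p‖ ≤ B + S * ‖p‖ := fun y p =>
        (norm_add_le _ _).trans (add_le_add (hB y) ((σ y).le_of_opNorm_le (hS y) p))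
      have hgn : ∀ y v, |fderiv ℝ φ y v| ≤ M * ‖v‖ := fun y v =>
        (fderiv ℝ φ y).le_of_opNorm_le (abs_le_and_norm_fderiv_le hM y).2 v
      have hinner : inner ℝ (z₁ u - z₂ u) (f₁ u - f₂ u) ≤ ‖z₁ u - z₂ u‖ *
          (K * ‖z₁ u - z₂ u‖ + K' * ‖z₁ u - z₂ u‖ * ‖ψ₁ u‖ + S * ‖ψ₁ u - ψ₂ u‖) := by
        refine (real_inner_le_norm _ _).trans ?_
        gcongr
        have e : f₁ u - f₂ u = (b (z₁ u) - b (z₂ u)) + (σ (z₁ u) - σ (z₂ u)) (ψ₁ u) +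
            σ (z₂ u) (ψ₁ u - ψ₂ u) := by
          simp only [hf₁, hf₂, sub_apply, map_sub]
          abel
        rw [e]
        refine (norm_add₃_le).trans (add_le_add (add_le_add ?_ ?_) ?_)
        · simpa [dist_eq_norm] using hK.dist_le_mul (z₁ u) (z₂ u)
        · exact ContinuousLinearMap.le_of_opNorm_le _
            (by simpa [dist_eq_norm] using hK'.dist_le_mul (z₁ u) (z₂ u)) _
        · exact (σ _).le_of_opNorm_le (hS _) _
      have hdb := drift_bound (l := l) hl0 (norm_nonneg (ψ₂ u)) hM0 K'.2 (hfn (z₁ u) (ψ₁ u))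
        (hfn (z₂ u) (ψ₂ u)) (hgn (z₁ u) (f₁ u)) (hgn (z₂ u) (f₂ u)) hinner
      refine (mul_le_mul_of_nonneg_left hdb (Real.exp_pos _).le).trans
        (mul_le_mul_of_nonneg_right (Real.exp_le_exp.2 ?_) (by positivity))
      have := (hAle u hu1).1
      have := mul_le_mul_of_nonneg_left (hφabs (z₁ u) (z₂ u)).1 hl0
      linarith
  rw [hw0, sub_zero] at hchain
  rw [integral_const_mul, integral_const_mul] at hJ0
  have hle : weightedSqDist φ l (w t) ≤
      Real.exp (2 * l * M) * (S ^ 2 * ∫ u in Ioc 0 t, ‖ψ₁ u - ψ₂ u‖ ^ 2) := by linarith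
  have hge : Real.exp (-(2 * l * M + R)) * ‖z₁ t - z₂ t‖ ^ 2 ≤ weightedSqDist φ l (w t) := by
    refine mul_le_mul_of_nonneg_right (Real.exp_le_exp.2 ?_) (sq_nonneg _)
    simp only [hw]
    have := (hAle t ht).2
    have := mul_le_mul_of_nonneg_left (hφabs (z₁ t) (z₂ t)).2 hl0
    linarith
  have hI : 0 ≤ ∫ u in Ioc 0 t, ‖ψ₁ u - ψ₂ u‖ ^ 2 := integral_nonneg fun _ => by positivity
  calc ‖z₁ t - z₂ t‖ ^ 2 = Real.exp (2 * l * M + R) *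
        (Real.exp (-(2 * l * M + R)) * ‖z₁ t - z₂ t‖ ^ 2) := by
        rw [← mul_assoc, ← Real.exp_add, add_neg_cancel, Real.exp_zero, one_mul]
    _ ≤ Real.exp (2 * l * M + R) *
        (Real.exp (2 * l * M) * (S ^ 2 * ∫ u in Ioc 0 t, ‖ψ₁ u - ψ₂ u‖ ^ 2)) := by
        exact mul_le_mul_of_nonneg_left (hge.trans hle) (Real.exp_pos _).le
    _ = Real.exp (4 * l * M + R) * S ^ 2 * ∫ u in Ioc 0 t, ‖ψ₁ u - ψ₂ u‖ ^ 2 := by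
        rw [← mul_assoc, ← mul_assoc, ← Real.exp_add]
        ring_nf
    _ ≤ _ := by
        gcongr
        linarith

end ReflectedSkeleton

/-! ### The catching-up scheme and its limit. -/

namespace ReflectedSkeleton

variable {E : Type*} [NormedAddCommGroup E] [InnerProductSpace ℝ E]

/-- The defect in the normal cone inequality at distance `d` over a time interval in which the
driving force has total mass `g`. -/
def coneDefect (C₀ d g : ℝ) : ℝ := (C₀ * (d + 2 * g) ^ 2 + 2 * g) * g

/-- Estimates for a chain of displacements, each followed by a projection. -/
theorem projected_chain_estimates {K : Set E} {C₀ : ℝ} (hC₀ : 0 ≤ C₀) {Z κ : ℕ → E} {γ : ℕ → ℝ}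
    (hκ : ∀ i, ‖κ (i + 1) - κ i‖ ≤ γ (i + 1) - γ i)
    (hZ : ∀ i, ‖Z (i + 1) - Z i‖ ≤ 2 * (γ (i + 1) - γ i))
    (hin : ∀ i, ∀ y ∈ K, 0 ≤ inner ℝ (Z (i + 1) - y) (κ (i + 1) - κ i) +
      C₀ * (γ (i + 1) - γ i) * ‖Z (i + 1) - y‖ ^ 2) {i j : ℕ} (hij : i ≤ j) :
    ‖κ j - κ i‖ ≤ γ j - γ i ∧ ‖Z j - Z i‖ ≤ 2 * (γ j - γ i) ∧
      ∀ y ∈ K, 0 ≤ inner ℝ (Z i - y) (κ j - κ i) + coneDefect C₀ ‖Z i - y‖ (γ j - γ i) := by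
  induction j, hij using Nat.le_induction with
  | base => simp [coneDefect]
  | succ j hij ih =>
    obtain ⟨h1, h2, h3⟩ := ih
    have e1 : κ (j + 1) - κ i = (κ (j + 1) - κ j) + (κ j - κ i) := by abel
    have e2 : Z (j + 1) - Z i = (Z (j + 1) - Z j) + (Z j - Z i) := by abel
    have hn1 : ‖κ (j + 1) - κ i‖ ≤ γ (j + 1) - γ i := by
      rw [e1]
      exact (norm_add_le _ _).trans (by linarith [hκ j])
    have hn2 : ‖Z (j + 1) - Z i‖ ≤ 2 * (γ (j + 1) - γ i) := by
      rw [e2]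
      exact (norm_add_le _ _).trans (by linarith [hZ j])
    refine ⟨hn1, hn2, fun y hy => ?_⟩
    have h4 := hin j y hy
    -- The inequality of the new step is based at `Z (j + 1)`; moving the base point to `Z i` costs
    -- this, which is the source of the term `2 * g` in `coneDefect`.
    have h5 : inner ℝ (Z (j + 1) - Z i) (κ (j + 1) - κ j) ≤
        2 * (γ (j + 1) - γ i) * (γ (j + 1) - γ j) :=
      (real_inner_le_norm _ _).trans
        (mul_le_mul hn2 (hκ j) (norm_nonneg _) ((norm_nonneg _).trans hn2))
    have e3 : inner ℝ (Z i - y) (κ (j + 1) - κ i) = inner ℝ (Z (j + 1) - y) (κ (j + 1) - κ j) -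
        inner ℝ (Z (j + 1) - Z i) (κ (j + 1) - κ j) + inner ℝ (Z i - y) (κ j - κ i) := by
      rw [e1, inner_add_right, ← inner_sub_left, sub_sub_sub_cancel_left]
    have h6 : ‖Z (j + 1) - y‖ ≤ ‖Z i - y‖ + 2 * (γ (j + 1) - γ i) := by
      have : Z (j + 1) - y = (Z i - y) + (Z (j + 1) - Z i) := by abel
      rw [this]
      exact (norm_add_le _ _).trans (by linarith)
    have hδ : 0 ≤ γ (j + 1) - γ j := (norm_nonneg _).trans (hκ j)
    have hg : 0 ≤ γ j - γ i := (norm_nonneg _).trans h1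
    have h7 : C₀ * (γ (j + 1) - γ j) * ‖Z (j + 1) - y‖ ^ 2 ≤
        C₀ * (γ (j + 1) - γ j) * (‖Z i - y‖ + 2 * (γ (j + 1) - γ i)) ^ 2 := by gcongr
    have h8 := h3 y hy
    have h9 : coneDefect C₀ ‖Z i - y‖ (γ j - γ i) ≤
        (C₀ * (‖Z i - y‖ + 2 * (γ (j + 1) - γ i)) ^ 2 + 2 * (γ (j + 1) - γ i)) * (γ j - γ i) := by
      unfold coneDefect
      gcongr <;> linarith
    rw [e3]
    unfold coneDefect at h8 h9 ⊢
    linarith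

/-- The last point of the grid `ℕ / (n + 1)` before time `t`. -/
def gridTime (n : ℕ) (t : ℝ) : ℝ := ⌊(n + 1 : ℝ) * t⌋₊ / (n + 1 : ℝ)

theorem gridTime_nonneg (n : ℕ) (t : ℝ) : 0 ≤ gridTime n t := by unfold gridTime; positivity

theorem gridTime_le (n : ℕ) {t : ℝ} (ht : 0 ≤ t) : gridTime n t ≤ t := by
  unfold gridTime
  rw [div_le_iff₀ (by positivity), mul_comm]
  exact Nat.floor_le (by positivity)

theorem sub_lt_gridTime (n : ℕ) (t : ℝ) : t - 1 / (n + 1 : ℝ) < gridTime n t := by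
  unfold gridTime
  rw [sub_lt_iff_lt_add, ← add_div, lt_div_iff₀ (by positivity), mul_comm]
  exact Nat.lt_floor_add_one _

theorem tendsto_gridTime {t : ℝ} (ht : 0 ≤ t) :
    Filter.Tendsto (fun n => gridTime n t) Filter.atTop (nhds t) := by
  have h : Filter.Tendsto (fun n : ℕ => t - 1 / (n + 1 : ℝ)) Filter.atTop (nhds (t - 0)) :=
    tendsto_const_nhds.sub tendsto_one_div_add_atTop_nhds_zero_nat
  rw [sub_zero] at h
  exact tendsto_of_tendsto_of_tendsto_of_le_of_le h tendsto_const_nhds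
    (fun n => (sub_lt_gridTime n t).le) (fun n => gridTime_le n ht)

/-- The data of the catching-up scheme: a set `K` with a projection step, and a bounded field. -/
structure IsCatchingUpData (K : Set E) (C₀ : ℝ) (f : ℝ → E → E) (G L : ℝ → ℝ) : Prop where
  C₀_nonneg : 0 ≤ C₀
  isCompact : IsCompact K
  step : ∀ z ∈ K, ∀ v : E, ∃ p ∈ K, ‖z + v - p‖ ≤ ‖v‖ ∧ ∀ y ∈ K,
    0 ≤ inner ℝ (p - y) (z + v - p) + C₀ * ‖v‖ * ‖p - y‖ ^ 2
  intervalIntegrable : ∀ (z : ℝ → E) (a b : ℝ), AEStronglyMeasurable z (volume.restrict (uIoc a b)) →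
    IntervalIntegrable (fun u => f u (z u)) volume a b
  norm_le : ∀ u z, ‖f u z‖ ≤ G u
  field_lipschitz : ∀ u z z', ‖f u z - f u z'‖ ≤ L u * ‖z - z'‖
  L_nonneg : ∀ u, 0 ≤ L u
  intervalIntegrable_G : ∀ a b, IntervalIntegrable G volume a b
  intervalIntegrable_L : ∀ a b, IntervalIntegrable L volume a b

namespace IsCatchingUpData

variable {K : Set E} {C₀ : ℝ} {f : ℝ → E → E} {G L : ℝ → ℝ}

theorem G_nonneg (h : IsCatchingUpData K C₀ f G L) (u : ℝ) : 0 ≤ G u :=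
  (norm_nonneg _).trans (h.norm_le u 0)

theorem norm_integral_le (h : IsCatchingUpData K C₀ f G L) (z : ℝ → E) {s t : ℝ} (hst : s ≤ t) :
    ‖∫ u in s..t, f u (z u)‖ ≤ (∫ u in (0 : ℝ)..t, G u) - ∫ u in (0 : ℝ)..s, G u := by
  rw [intervalIntegral.integral_interval_sub_left (h.intervalIntegrable_G _ _)
    (h.intervalIntegrable_G _ _)]
  exact intervalIntegral.norm_integral_le_of_norm_le hst
    (Filter.Eventually.of_forall fun u _ => h.norm_le u _) (h.intervalIntegrable_G _ _)

/-- The catching-up scheme on the grid `ℕ / (n + 1)`. -/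
theorem exists_scheme (h : IsCatchingUpData K C₀ f G L) {x : E} (hx : x ∈ K) (n : ℕ) :
    ∃ z k : ℝ → E, StronglyMeasurable z ∧ (∀ t, z t ∈ K) ∧ z 0 = x ∧
      (∀ t, z t = x + (∫ u in (0 : ℝ)..gridTime n t, f u (z u)) - k t) ∧
      ∀ s t, s ≤ t → ∀ g, g = (∫ u in (0 : ℝ)..gridTime n t, G u) -
          (∫ u in (0 : ℝ)..gridTime n s, G u) →
        ‖k t - k s‖ ≤ g ∧ ‖z t - z s‖ ≤ 2 * g ∧
        ∀ y ∈ K, 0 ≤ inner ℝ (z s - y) (k t - k s) + coneDefect C₀ ‖z s - y‖ g := by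
  have hN : (0 : ℝ) < n + 1 := by positivity
  have hstep := h.step
  choose! P hPK hPn hPi using hstep
  set T : ℕ → ℝ := fun i => (i : ℝ) / (n + 1 : ℝ) with hT
  have hTmono : ∀ i, T i ≤ T (i + 1) := fun i => by
    simp only [hT]
    gcongr
    simp
  set V : ℕ → E → E := fun i y => ∫ u in T i..T (i + 1), f u y with hV
  -- Displacement by the field integrated over one cell with the state frozen, then projection.
  set Z : ℕ → E := fun i => Nat.rec x (fun i y => P y (V i y)) i with hZdef
  have hZs : ∀ i, Z (i + 1) = P (Z i) (V i (Z i)) := fun i => rfl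
  have hZK : ∀ i, Z i ∈ K := by
    intro i
    induction i with
    | zero => exact hx
    | succ i ih => rw [hZs]; exact hPK _ ih _
  set κ : ℕ → E := fun i => x + (∑ l ∈ Finset.range i, V l (Z l)) - Z i with hκdef
  set γ : ℕ → ℝ := fun i => ∫ u in (0 : ℝ)..T i, G u with hγ
  have hκs : ∀ i, κ (i + 1) - κ i = Z i + V i (Z i) - Z (i + 1) := by
    intro i
    simp only [hκdef, Finset.sum_range_succ]
    abel
  have hVn : ∀ i, ‖V i (Z i)‖ ≤ γ (i + 1) - γ i := fun i =>
    h.norm_integral_le (fun _ => Z i) (hTmono i)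
  have hκ : ∀ i, ‖κ (i + 1) - κ i‖ ≤ γ (i + 1) - γ i := by
    intro i
    rw [hκs, hZs]
    exact (hPn _ (hZK i) _).trans (hVn i)
  -- The factor `2` counts the displacement and the projection, each at most the mass of the cell.
  have hZd : ∀ i, ‖Z (i + 1) - Z i‖ ≤ 2 * (γ (i + 1) - γ i) := by
    intro i
    have e : Z (i + 1) - Z i = V i (Z i) - (κ (i + 1) - κ i) := by rw [hκs]; abel
    rw [e]
    refine (norm_sub_le _ _).trans ?_
    linarith [hVn i, hκ i]
  have hin : ∀ i, ∀ y ∈ K, 0 ≤ inner ℝ (Z (i + 1) - y) (κ (i + 1) - κ i) +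
      C₀ * (γ (i + 1) - γ i) * ‖Z (i + 1) - y‖ ^ 2 := by
    intro i y hy
    have h1 := hPi _ (hZK i) (V i (Z i)) y hy
    rw [← hZs, ← hκs] at h1
    have h2 : C₀ * ‖V i (Z i)‖ * ‖Z (i + 1) - y‖ ^ 2 ≤
        C₀ * (γ (i + 1) - γ i) * ‖Z (i + 1) - y‖ ^ 2 := by
      have := h.C₀_nonneg
      have := hVn i
      gcongr
    linarith
  have hgrid : ∀ t, gridTime n t = T ⌊(n + 1 : ℝ) * t⌋₊ := fun t => rfl
  refine ⟨fun t => Z ⌊(n + 1 : ℝ) * t⌋₊, fun t => κ ⌊(n + 1 : ℝ) * t⌋₊, ?_, fun t => hZK _,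
    by simp [hZdef], ?_, ?_⟩
  · exact (StronglyMeasurable.of_discrete (f := Z)).comp_measurable
      (Nat.measurable_floor.comp (measurable_const.mul measurable_id))
  · intro t
    rw [hgrid]
    dsimp only
    generalize ⌊(n + 1 : ℝ) * t⌋₊ = i
    have hsum := intervalIntegral.sum_integral_adjacent_intervals (a := T) (n := i)
      (μ := volume) (f := fun u => f u (Z ⌊(n + 1 : ℝ) * u⌋₊)) (fun l _ =>
        h.intervalIntegrable _ _ _ ((StronglyMeasurable.of_discrete (f := Z)).comp_measurable
          (Nat.measurable_floor.comp
            (measurable_const.mul measurable_id))).aestronglyMeasurable)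
    have hT0 : T 0 = 0 := by simp [hT]
    rw [hT0] at hsum
    rw [← hsum]
    -- Inside a cell the step function is the frozen state, so the integral equation holds exactly
    -- up to the last grid time.
    have hpiece : ∀ l, ∫ u in T l..T (l + 1), f u (Z ⌊(n + 1 : ℝ) * u⌋₊) = V l (Z l) := by
      intro l
      refine intervalIntegral.integral_congr_uIoo ?_
      rw [uIoo_of_le (hTmono l)]
      intro u hu
      have h1 : (l : ℝ) < u * (n + 1) := (div_lt_iff₀ hN).1 hu.1
      have h2 : u * (n + 1) < (l + 1 : ℕ) := (lt_div_iff₀ hN).1 hu.2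
      have : ⌊(n + 1 : ℝ) * u⌋₊ = l := by
        rw [mul_comm]
        refine (Nat.floor_eq_iff ((Nat.cast_nonneg l).trans h1.le)).2 ⟨h1.le, ?_⟩
        exact_mod_cast h2
      simp only [this]
    rw [Finset.sum_congr rfl fun l _ => hpiece l]
    simp only [hκdef]
    abel
  · rintro s t hst g rfl
    have hij : ⌊(n + 1 : ℝ) * s⌋₊ ≤ ⌊(n + 1 : ℝ) * t⌋₊ :=
      Nat.floor_mono (mul_le_mul_of_nonneg_left hst hN.le)
    exact projected_chain_estimates h.C₀_nonneg hκ hZd hin hij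

/-- Compactness of `K` gives pointwise limits along an ultrafilter, without extracting subsequences;
the common modulus of continuity makes the convergence uniform on `[0, 1]`, and the estimates pass
to the limit at fixed `s` and `t`. -/
theorem exists_limit (h : IsCatchingUpData K C₀ f G L) {x : E} (hx : x ∈ K) :
    ∃ z k : ℝ → E, ContinuousOn z (Icc 0 1) ∧ (∀ t, z t ∈ K) ∧ k 0 = 0 ∧
      (∀ t ∈ Icc (0 : ℝ) 1, z t = x + (∫ u in (0 : ℝ)..t, f u (z u)) - k t) ∧
      ∀ s t, 0 ≤ s → s ≤ t → t ≤ 1 → ∀ g, g = ∫ u in s..t, G u →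
        ‖k t - k s‖ ≤ g ∧
        ∀ y ∈ K, 0 ≤ inner ℝ (z s - y) (k t - k s) + coneDefect C₀ ‖z s - y‖ g := by
  choose zn kn hzm hzK hz0 hzeq hest using fun n => h.exists_scheme hx n
  set U : Filter ℕ := (Filter.hyperfilter ℕ : Filter ℕ) with hU
  have hUle : U ≤ Filter.atTop := Nat.hyperfilter_le_atTop
  set Γ : ℝ → ℝ := fun t => ∫ u in (0 : ℝ)..t, G u with hΓ
  have hΓc : Continuous Γ := intervalIntegral.continuous_primitive h.intervalIntegrable_G 0
  have hlim : ∀ t, ∃ y ∈ K, Filter.Tendsto (fun n => zn n t) U (nhds y) := by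
    intro t
    obtain ⟨y, hy, hle⟩ := h.isCompact.ultrafilter_le_nhds'
      ((Filter.hyperfilter ℕ).map fun n => zn n t)
      (Filter.mem_map.2 (Filter.univ_mem' fun n => hzK n t))
    exact ⟨y, hy, hle⟩
  choose z hz hzlim using hlim
  have hΓlim : ∀ t, 0 ≤ t → Filter.Tendsto (fun n => Γ (gridTime n t)) U (nhds (Γ t)) :=
    fun t ht => (hΓc.tendsto t).comp ((tendsto_gridTime ht).mono_left hUle)
  have hgaplim : ∀ s t, 0 ≤ s → 0 ≤ t → Filter.Tendsto
      (fun n => Γ (gridTime n t) - Γ (gridTime n s)) U (nhds (Γ t - Γ s)) :=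
    fun s t hs ht => (hΓlim t ht).sub (hΓlim s hs)
  have hznabs : ∀ n s t, ‖zn n t - zn n s‖ ≤ 2 * |Γ (gridTime n t) - Γ (gridTime n s)| := by
    intro n s t
    rcases le_total s t with hst | hst
    · exact (hest n s t hst _ rfl).2.1.trans (by gcongr; exact le_abs_self _)
    · rw [norm_sub_rev, abs_sub_comm]
      exact (hest n t s hst _ rfl).2.1.trans (by gcongr; exact le_abs_self _)
  have hzabs : ∀ s t, 0 ≤ s → 0 ≤ t → ‖z t - z s‖ ≤ 2 * |Γ t - Γ s| := fun s t hs ht =>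
    le_of_tendsto_of_tendsto ((hzlim t).sub (hzlim s)).norm ((hgaplim s t hs ht).abs.const_mul 2)
      (Filter.Eventually.of_forall fun n => hznabs n s t)
  have hzc : ContinuousOn z (Icc 0 1) := by
    intro s hs
    rw [ContinuousWithinAt, tendsto_iff_norm_sub_tendsto_zero]
    have h1 : Filter.Tendsto (fun t => 2 * |Γ t - Γ s|) (nhdsWithin s (Icc 0 1)) (nhds 0) := by
      have : Continuous fun t => 2 * |Γ t - Γ s| := by fun_prop
      simpa using (this.tendsto s).mono_left nhdsWithin_le_nhds
    refine squeeze_zero' (Filter.Eventually.of_forall fun _ => norm_nonneg _) ?_ h1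
    filter_upwards [self_mem_nhdsWithin] with t ht using hzabs s t hs.1 ht.1
  have hunif : TendstoUniformlyOn zn z U (Icc 0 1) := by
    rw [← tendstoLocallyUniformlyOn_iff_tendstoUniformlyOn_of_compact isCompact_Icc,
      Metric.tendstoLocallyUniformlyOn_iff]
    intro ε hε u hu
    -- Half of `δ` is for `|t - u|` and half for the mesh. The three errors below are then at most
    -- `ε / 8`, `ε / 4` and `ε / 4`.
    obtain ⟨δ, hδ, hΓδ⟩ := Metric.continuous_iff.1 hΓc u (ε / 16) (by positivity)
    refine ⟨Metric.ball u (δ / 2) ∩ Icc 0 1, Filter.inter_mem (mem_nhdsWithin_of_mem_nhds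
      (Metric.ball_mem_nhds u (by positivity))) self_mem_nhdsWithin, ?_⟩
    have hn1 : ∀ᶠ n : ℕ in U, 1 / (n + 1 : ℝ) < δ / 2 :=
      hUle (tendsto_one_div_add_atTop_nhds_zero_nat.eventually (gt_mem_nhds (by positivity)))
    have hn2 : ∀ᶠ n in U, dist (zn n u) (z u) < ε / 4 :=
      (hzlim u).eventually (Metric.ball_mem_nhds _ (by positivity))
    filter_upwards [hn1, hn2] with n hn hnu t ht
    have hgr : ∀ s ∈ Metric.ball u (δ / 2) ∩ Icc 0 1, |Γ (gridTime n s) - Γ u| < ε / 16 := by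
      intro s hs
      refine hΓδ _ ?_
      have hs1 := abs_lt.1 (show |s - u| < δ / 2 from hs.1)
      rw [Real.dist_eq, abs_lt]
      have := sub_lt_gridTime n s
      have := gridTime_le n hs.2.1
      constructor <;> linarith
    have hΓt : |Γ t - Γ u| < ε / 16 := hΓδ t (by
      have := ht.1
      rw [Metric.mem_ball] at this
      linarith)
    have h1 := hznabs n u t
    have h2 := hzabs u t hu.1 ht.2.1
    have h3 : |Γ (gridTime n t) - Γ (gridTime n u)| ≤ ε / 16 + ε / 16 := by
      have a1 := hgr t ht
      have a2 := hgr u ⟨Metric.mem_ball_self (by positivity), hu⟩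
      rw [abs_sub_comm] at a2
      exact (abs_sub_le _ (Γ u) _).trans (add_le_add a1.le a2.le)
    rw [dist_eq_norm] at hnu ⊢
    have e : z t - zn n t = (z t - z u) - (zn n u - z u) - (zn n t - zn n u) := by abel
    rw [e]
    refine (norm_sub_le _ _).trans_lt ?_
    have := norm_sub_le (z t - z u) (zn n u - z u)
    linarith
  have hzint : ∀ t ∈ Icc (0 : ℝ) 1, IntervalIntegrable (fun u => f u (z u)) volume 0 t := by
    intro t ht
    refine h.intervalIntegrable _ _ _ ((hzc.mono ?_).aestronglyMeasurable measurableSet_uIoc)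
    rw [uIoc_of_le ht.1]
    exact fun u hu => ⟨hu.1.le, hu.2.trans ht.2⟩
  -- Two errors: moving the endpoint from the grid time to `t`, bounded by an increment of `Γ`, and
  -- replacing `zn n` by `z`, bounded by the uniform distance times the integral of `L`.
  have hFlim : ∀ t ∈ Icc (0 : ℝ) 1, Filter.Tendsto
      (fun n => ∫ u in (0 : ℝ)..gridTime n t, f u (zn n u)) U
      (nhds (∫ u in (0 : ℝ)..t, f u (z u))) := by
    intro t ht
    have hgI : ∀ n, gridTime n t ∈ Icc (0 : ℝ) 1 := fun n =>
      ⟨gridTime_nonneg n t, (gridTime_le n ht.1).trans ht.2⟩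
    have hA : Filter.Tendsto (fun n => ∫ u in (0 : ℝ)..gridTime n t, f u (z u)) U
        (nhds (∫ u in (0 : ℝ)..t, f u (z u))) := by
      rw [tendsto_iff_norm_sub_tendsto_zero]
      have h0 : Filter.Tendsto (fun n => Γ t - Γ (gridTime n t)) U (nhds 0) := by
        simpa using (hΓlim t ht.1).const_sub (Γ t)
      refine squeeze_zero (fun _ => norm_nonneg _) (fun n => ?_) h0
      rw [norm_sub_rev, intervalIntegral.integral_interval_sub_left (hzint t ht)
        (hzint _ (hgI n))]
      exact h.norm_integral_le z (gridTime_le n ht.1)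
    have hB : Filter.Tendsto (fun n => (∫ u in (0 : ℝ)..gridTime n t, f u (zn n u)) -
        ∫ u in (0 : ℝ)..gridTime n t, f u (z u)) U (nhds 0) := by
      rw [Metric.tendsto_nhds]
      intro ε hε
      set I := ∫ u in (0 : ℝ)..1, L u with hI
      have hI0 : 0 ≤ I := intervalIntegral.integral_nonneg zero_le_one fun u _ => h.L_nonneg u
      filter_upwards [Metric.tendstoUniformlyOn_iff.1 hunif (ε / (I + 1)) (by positivity)]
        with n hn
      rw [dist_zero_right, ← intervalIntegral.integral_sub
        (h.intervalIntegrable _ _ _ (hzm n).aestronglyMeasurable) (hzint _ (hgI n))]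
      have h1 : ‖∫ u in (0 : ℝ)..gridTime n t, (f u (zn n u) - f u (z u))‖ ≤
          ∫ u in (0 : ℝ)..gridTime n t, ε / (I + 1) * L u := by
        refine intervalIntegral.norm_integral_le_of_norm_le (hgI n).1
          (Filter.Eventually.of_forall fun u hu => ?_) ((h.intervalIntegrable_L _ _).const_mul _)
        refine (h.field_lipschitz u _ _).trans ?_
        rw [mul_comm]
        refine mul_le_mul_of_nonneg_right ?_ (h.L_nonneg u)
        rw [norm_sub_rev, ← dist_eq_norm]
        exact (hn u ⟨hu.1.le, hu.2.trans (hgI n).2⟩).le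
      rw [intervalIntegral.integral_const_mul] at h1
      have h2 : ∫ u in (0 : ℝ)..gridTime n t, L u ≤ I := by
        rw [hI, ← sub_nonneg, intervalIntegral.integral_interval_sub_left
          (h.intervalIntegrable_L _ _) (h.intervalIntegrable_L _ _)]
        exact intervalIntegral.integral_nonneg (hgI n).2 fun u _ => h.L_nonneg u
      refine h1.trans_lt ?_
      calc ε / (I + 1) * ∫ u in (0 : ℝ)..gridTime n t, L u ≤ ε / (I + 1) * I := by gcongr
        _ < ε / (I + 1) * (I + 1) := by gcongr; linarith
        _ = ε := by field_simp
    simpa using hB.add hA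
  -- Defined as the residual of the equation, and then recognized as the limit of the discrete
  -- reflections.
  set k : ℝ → E := fun t => x + (∫ u in (0 : ℝ)..t, f u (z u)) - z t with hk
  have hklim : ∀ t ∈ Icc (0 : ℝ) 1, Filter.Tendsto (fun n => kn n t) U (nhds (k t)) := by
    intro t ht
    have e : ∀ n, kn n t = x + (∫ u in (0 : ℝ)..gridTime n t, f u (zn n u)) - zn n t := by
      intro n
      have := hzeq n t
      rw [eq_sub_iff_add_eq] at this
      rw [eq_sub_iff_add_eq, add_comm, this]
    simp_rw [e]
    exact (tendsto_const_nhds.add (hFlim t ht)).sub (hzlim t)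
  refine ⟨z, k, hzc, hz, ?_, fun t _ => by simp [hk], ?_⟩
  · have := tendsto_nhds_unique (hzlim 0) (tendsto_const_nhds.congr fun n => (hz0 n).symm)
    simp [hk, this]
  · rintro s t hs hst ht g rfl
    have e : ∫ u in s..t, G u = Γ t - Γ s :=
      (intervalIntegral.integral_interval_sub_left (h.intervalIntegrable_G _ _)
        (h.intervalIntegrable_G _ _)).symm
    have ht0 := hs.trans hst
    have hkd := (hklim t ⟨ht0, ht⟩).sub (hklim s ⟨hs, hst.trans ht⟩)
    have hg := hgaplim s t hs ht0
    rw [e]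
    refine ⟨le_of_tendsto_of_tendsto hkd.norm hg
      (Filter.Eventually.of_forall fun n => (hest n s t hst _ rfl).1), fun y hy => ?_⟩
    have hzy := (hzlim s).sub_const y
    have hcone : Filter.Tendsto (fun n => coneDefect C₀ ‖zn n s - y‖
        (Γ (gridTime n t) - Γ (gridTime n s))) U
        (nhds (coneDefect C₀ ‖z s - y‖ (Γ t - Γ s))) := by
      unfold coneDefect
      exact ((((hzy.norm.add (hg.const_mul 2)).pow 2).const_mul C₀).add (hg.const_mul 2)).mul hg
    exact ge_of_tendsto' ((hzy.inner hkd).add hcone) fun n => (hest n s t hst _ rfl).2.2 y hy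

end IsCatchingUpData

end ReflectedSkeleton

/-! ### Densities, total variation and infinitesimal cone inequalities. -/

namespace ReflectedSkeleton

variable {E : Type*} [NormedAddCommGroup E]

theorem absolutelyContinuousOnInterval_of_norm_sub_le {k : ℝ → E} {G : ℝ → ℝ} {a b : ℝ}
    (hab : a ≤ b) (hG : IntervalIntegrable G volume a b)
    (hk : ∀ s t, a ≤ s → s ≤ t → t ≤ b → ‖k t - k s‖ ≤ ∫ u in s..t, G u) :
    AbsolutelyContinuousOnInterval k a b := by
  have h := hG.absolutelyContinuousOnInterval_intervalIntegral left_mem_uIcc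
  have hle : ∀ s t, a ≤ s → s ≤ t → t ≤ b →
      dist (k s) (k t) ≤ dist (∫ u in a..s, G u) (∫ u in a..t, G u) := by
    intro s t has hst htb
    have hi : ∀ r, a ≤ r → r ≤ b → IntervalIntegrable G volume a r := fun r h1 h2 =>
      hG.mono_set (by rw [uIcc_of_le h1, uIcc_of_le hab]; exact Icc_subset_Icc_right h2)
    rw [dist_comm, dist_comm (∫ u in a..s, G u), dist_eq_norm, Real.dist_eq,
      intervalIntegral.integral_interval_sub_left (hi t (has.trans hst) htb)
        (hi s has (hst.trans htb))]
    exact (hk s t has hst htb).trans (le_abs_self _)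
  refine squeeze_zero' (Filter.Eventually.of_forall fun _ =>
    Finset.sum_nonneg fun _ _ => dist_nonneg) ?_ h
  rw [Filter.eventually_inf_principal]
  refine Filter.Eventually.of_forall fun I hI => Finset.sum_le_sum fun i hi => ?_
  obtain ⟨h1, h2⟩ := hI.1 i hi
  rw [uIcc_of_le hab] at h1 h2
  rcases le_total (I.2 i).1 (I.2 i).2 with h3 | h3
  · exact hle _ _ h1.1 h3 h2.2
  · rw [dist_comm, dist_comm (∫ u in a..(I.2 i).1, G u)]
    exact hle _ _ h2.1 h3 h1.2

theorem norm_deriv_le_of_norm_sub_le [NormedSpace ℝ E] {k : ℝ → E} {g : ℝ → ℝ} {v : E} {c t : ℝ}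
    (hk : HasDerivAt k v t) (hg : HasDerivAt g c t)
    (h : ∀ᶠ s in nhdsWithin t (Ioi t), ‖k s - k t‖ ≤ g s - g t) : ‖v‖ ≤ c := by
  have hsub : nhdsWithin t (Ioi t) ≤ nhdsWithin t {t}ᶜ :=
    nhdsWithin_mono t fun s (hs : t < s) => hs.ne'
  have hk' := (hasDerivAt_iff_tendsto_slope.1 hk).mono_left hsub
  have hg' := (hasDerivAt_iff_tendsto_slope.1 hg).mono_left hsub
  refine le_of_tendsto_of_tendsto hk'.norm hg' ?_
  filter_upwards [h, self_mem_nhdsWithin] with s hs hts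
  have hpos : 0 < s - t := sub_pos.2 hts
  rw [slope_def_module, slope_def_module, norm_smul, norm_inv, Real.norm_of_nonneg hpos.le,
    smul_eq_mul]
  gcongr

theorem ae_Ioo_of_Icc {p : ℝ → Prop} (h : ∀ᵐ t, t ∈ Ioo (0 : ℝ) 1 → p t) :
    ∀ᵐ t, t ∈ Ioc (0 : ℝ) 1 → p t := by
  have h1 : ∀ᵐ t : ℝ, t ≠ 1 := by simp [ae_iff, measure_singleton]
  filter_upwards [h, h1] with t ht ht1 htm
  exact ht ⟨htm.1, lt_of_le_of_ne htm.2 ht1⟩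

/-- A function whose increments are dominated by an integral has a density. -/
theorem exists_density [NormedSpace ℝ E] [FiniteDimensional ℝ E] {k : ℝ → E} {G : ℝ → ℝ}
    (hG : ∀ a b, IntervalIntegrable G volume a b)
    (hk : ∀ s t, 0 ≤ s → s ≤ t → t ≤ 1 → ‖k t - k s‖ ≤ ∫ u in s..t, G u) :
    ∃ h : ℝ → E, StronglyMeasurable h ∧ Integrable h ∧ (∀ t ∉ Ioc (0 : ℝ) 1, h t = 0) ∧
      (∀ᵐ t, t ∈ Ioo (0 : ℝ) 1 → HasDerivAt k (h t) t) ∧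
      ∀ t ∈ Icc (0 : ℝ) 1, k t = k 0 + ∫ u in (0 : ℝ)..t, h u := by
  have : CompleteSpace E := FiniteDimensional.complete ℝ E
  have hac := absolutelyContinuousOnInterval_of_norm_sub_le zero_le_one (hG 0 1) hk
  set h : ℝ → E := (Ioc (0 : ℝ) 1).indicator (deriv k) with hh
  have hm : StronglyMeasurable h := (stronglyMeasurable_deriv k).indicator measurableSet_Ioc
  have hd : ∀ᵐ t, t ∈ Ioo (0 : ℝ) 1 → HasDerivAt k (h t) t := by
    filter_upwards [hac.boundedVariationOn.ae_differentiableAt_of_mem_uIcc] with t ht htm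
    rw [hh, indicator_of_mem (Ioo_subset_Ioc_self htm)]
    refine (ht ?_).hasDerivAt
    rw [uIcc_of_le zero_le_one]
    exact Ioo_subset_Icc_self htm
  have hle : ∀ᵐ t, t ∈ Ioo (0 : ℝ) 1 → ‖h t‖ ≤ G t := by
    filter_upwards [hd, (hG 0 1).ae_hasDerivAt_integral] with t h1 h2 ht
    have htu : t ∈ uIcc (0 : ℝ) 1 := by
      rw [uIcc_of_le zero_le_one]
      exact Ioo_subset_Icc_self ht
    refine norm_deriv_le_of_norm_sub_le (h1 ht) (h2 htu 0 left_mem_uIcc) ?_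
    filter_upwards [Ioo_mem_nhdsGT ht.2] with s hs
    rw [intervalIntegral.integral_interval_sub_left (hG _ _) (hG _ _)]
    exact hk t s ht.1.le hs.1.le hs.2.le
  have hi : Integrable h := by
    rw [hh, integrable_indicator_iff measurableSet_Ioc]
    refine Integrable.mono' (g := G)
      ((intervalIntegrable_iff_integrableOn_Ioc_of_le zero_le_one).1 (hG 0 1))
      (stronglyMeasurable_deriv k).aestronglyMeasurable ?_
    rw [ae_restrict_iff' measurableSet_Ioc]
    filter_upwards [ae_Ioo_of_Icc hle] with t ht htm
    have := ht htm
    rwa [hh, indicator_of_mem htm] at this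
  refine ⟨h, hm, hi, fun t ht => indicator_of_notMem ht _, hd, ?_⟩
  have hii : ∀ a b, IntervalIntegrable h volume a b := fun a b => hi.intervalIntegrable
  have hac' : AbsolutelyContinuousOnInterval (fun t => ∫ u in (0 : ℝ)..t, h u) 0 1 := by
    refine absolutelyContinuousOnInterval_of_norm_sub_le (G := fun u => ‖h u‖) zero_le_one
      (hii 0 1).norm fun s t _ hst _ => ?_
    rw [intervalIntegral.integral_interval_sub_left (hii _ _) (hii _ _)]
    exact intervalIntegral.norm_integral_le_integral_norm hst
  -- The difference of `k` and the integral of its derivative is absolutely continuous with zero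
  -- derivative almost everywhere, hence constant.
  obtain ⟨C, hC⟩ := (hac.sub hac').const_of_ae_hasDerivAt_zero (by
    have h0 : ∀ᵐ t : ℝ, t ≠ 0 := by simp [ae_iff, measure_singleton]
    have h1 : ∀ᵐ t : ℝ, t ≠ 1 := by simp [ae_iff, measure_singleton]
    filter_upwards [hd, (hii 0 1).ae_hasDerivAt_integral, h0, h1] with t ht1 ht2 h0 h1 htu
    have htu' := htu
    rw [uIcc_of_le zero_le_one] at htu'
    have := (ht1 ⟨lt_of_le_of_ne htu'.1 h0.symm, lt_of_le_of_ne htu'.2 h1⟩).sub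
      (ht2 htu 0 left_mem_uIcc)
    rwa [sub_self] at this)
  intro t ht
  have e1 := hC t (by rwa [uIcc_of_le zero_le_one])
  have e2 := hC 0 left_mem_uIcc
  simp only [Pi.sub_apply, intervalIntegral.integral_same, sub_zero] at e1 e2
  rw [e2, ← e1]
  abel

/-- The total variation of an indefinite integral is the integral of the norm. -/
theorem totalVariation_eq_integral [InnerProductSpace ℝ E] [CompleteSpace E] {k h : ℝ → E}
    (hi : Integrable h) (h0 : ∀ t ∉ Ioc (0 : ℝ) 1, h t = 0)
    (hd : ∀ᵐ t, t ∈ Ioo (0 : ℝ) 1 → HasDerivAt k (h t) t)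
    (hk : ∀ t ∈ Icc (0 : ℝ) 1, k t = k 0 + ∫ u in (0 : ℝ)..t, h u) :
    BoundedVariationOn k (Icc 0 1) ∧
      ∀ t, totalVariation k t = ∫ u in (0 : ℝ)..t, ‖h u‖ := by
  have hii : ∀ a b, IntervalIntegrable h volume a b := fun a b => hi.intervalIntegrable
  set N : ℝ → ℝ := fun t => ∫ u in (0 : ℝ)..t, ‖h u‖ with hN
  have hNsub : ∀ s t, N t - N s = ∫ u in s..t, ‖h u‖ := fun s t =>
    intervalIntegral.integral_interval_sub_left (hii _ _).norm (hii _ _).norm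
  have hNmono : Monotone N := by
    intro s t hst
    rw [← sub_nonneg, hNsub]
    exact intervalIntegral.integral_nonneg hst fun _ _ => norm_nonneg _
  have hinc : ∀ s ∈ Icc (0 : ℝ) 1, ∀ t ∈ Icc (0 : ℝ) 1, s ≤ t → edist (k t) (k s) ≤
      edist (N t) (N s) := by
    intro s hs t ht hst
    rw [edist_dist, edist_dist, dist_eq_norm, Real.dist_eq, hk t ht, hk s hs,
      add_sub_add_left_eq_sub, intervalIntegral.integral_interval_sub_left (hii _ _) (hii _ _),
      hNsub]
    exact ENNReal.ofReal_le_ofReal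
      ((intervalIntegral.norm_integral_le_integral_norm hst).trans (le_abs_self _))
  have hle : ∀ t ∈ Icc (0 : ℝ) 1, eVariationOn k (Icc 0 t) ≤ ENNReal.ofReal (N t) := by
    intro t ht
    have h1 : eVariationOn k (Icc 0 t) ≤ eVariationOn N (Icc 0 t) := by
      refine iSup_mono fun p => Finset.sum_le_sum fun i _ => ?_
      have hm := p.2.2.2
      have hm' := p.2.2.1 (Nat.le_succ i)
      exact hinc _ ⟨(hm i).1, (hm i).2.trans ht.2⟩ _ ⟨(hm (i + 1)).1, (hm (i + 1)).2.trans ht.2⟩ hm'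
    have h2 := (hNmono.monotoneOn (Icc 0 t)).eVariationOn_eq (left_mem_Icc.2 ht.1)
      (right_mem_Icc.2 ht.1)
    rw [inter_self] at h2
    rw [h2] at h1
    simpa [hN] using h1
  have hbv : BoundedVariationOn k (Icc 0 1) :=
    ne_top_of_le_ne_top ENNReal.ofReal_ne_top (hle 1 ⟨zero_le_one, le_rfl⟩)
  refine ⟨hbv, ?_⟩
  set V := totalVariation k with hV
  have hVmono : Monotone V := monotone_totalVariation hbv
  have hVeq : ∀ t ∈ Icc (0 : ℝ) 1, V t = (eVariationOn k (Icc 0 t)).toReal := fun t ht => by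
    rw [hV, totalVariation, min_eq_left ht.2]
  have hV0 : V 0 = 0 := by
    rw [hVeq 0 ⟨le_rfl, zero_le_one⟩, Icc_self, eVariationOn.subsingleton _ subsingleton_singleton,
      ENNReal.toReal_zero]
  have hVinc : ∀ s t, 0 ≤ s → s ≤ t → t ≤ 1 → ‖k t - k s‖ ≤ V t - V s := by
    intro s t hs hst ht
    have hsum := eVariationOn.Icc_add_Icc k (s := univ) hs hst (mem_univ _)
    simp only [univ_inter] at hsum
    have hf : ∀ {a b : ℝ}, 0 ≤ a → b ≤ 1 → eVariationOn k (Icc a b) ≠ ∞ := fun ha hb =>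
      hbv.mono (Icc_subset_Icc ha hb)
    rw [hVeq t ⟨hs.trans hst, ht⟩, hVeq s ⟨hs, hst.trans ht⟩, ← hsum,
      ENNReal.toReal_add (hf le_rfl (hst.trans ht)) (hf hs ht), add_sub_cancel_left,
      ← dist_eq_norm, dist_edist]
    exact ENNReal.toReal_mono (hf hs ht)
      (eVariationOn.edist_le k (right_mem_Icc.2 hst) (left_mem_Icc.2 hst))
  have hmain : ∀ t ∈ Icc (0 : ℝ) 1, V t = N t := by
    intro t ht
    apply le_antisymm
    · rw [hVeq t ht]
      refine ENNReal.toReal_le_of_le_ofReal ?_ (hle t ht)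
      exact intervalIntegral.integral_nonneg ht.1 fun _ _ => norm_nonneg _
    -- For the lower bound, the variation dominates the increments of `k`, so `|h| ≤ V'` almost
    -- everywhere, and the integral of `V'` over `[0, t]` is at most `V t` by monotonicity.
    · have hVi := (hVmono.monotoneOn (uIcc 0 t)).intervalIntegrable_deriv
      have hVd := (hVmono.monotoneOn (uIcc 0 t)).intervalIntegral_deriv_mem_uIcc
      rw [hV0, sub_zero, uIcc_of_le (hV0 ▸ hVmono ht.1)] at hVd
      refine le_trans ?_ hVd.2
      refine intervalIntegral.integral_mono_ae_restrict ht.1 (hii 0 t).norm hVi ?_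
      have hptw : ∀ᵐ u, u ∈ Ioo (0 : ℝ) 1 → ‖h u‖ ≤ deriv V u := by
        filter_upwards [hd, hVmono.ae_differentiableAt] with u hu1 hu2 hu
        refine norm_deriv_le_of_norm_sub_le (hu1 hu) hu2.hasDerivAt ?_
        filter_upwards [Ioo_mem_nhdsGT hu.2] with s hs
        exact hVinc u s hu.1.le hs.1.le hs.2.le
      have hne : ∀ᵐ u : ℝ, u ≠ 0 := by simp [ae_iff, measure_singleton]
      refine (ae_restrict_iff' measurableSet_Icc).2 ?_
      filter_upwards [ae_Ioo_of_Icc hptw, hne] with u hu hu0 hum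
      exact hu ⟨lt_of_le_of_ne hum.1 hu0.symm, hum.2.trans ht.2⟩
  intro t
  rcases lt_trichotomy t 0 with ht | rfl | ht
  · have e1 : V t = 0 := by
      rw [hV, totalVariation, Icc_eq_empty (by rw [not_le]; exact (min_le_left _ _).trans_lt ht)]
      rw [eVariationOn.subsingleton _ subsingleton_empty, ENNReal.toReal_zero]
    rw [e1, intervalIntegral.integral_symm, eq_comm, neg_eq_zero,
      intervalIntegral.integral_of_le ht.le]
    refine setIntegral_eq_zero_of_forall_eq_zero fun u hu => ?_
    rw [h0 u fun hu' => absurd hu.2 (not_le.2 hu'.1), norm_zero]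
  · exact hmain 0 ⟨le_rfl, zero_le_one⟩
  · rcases le_or_gt t 1 with ht1 | ht1
    · exact hmain t ⟨ht.le, ht1⟩
    · have e1 : V t = V 1 := by simp [hV, totalVariation, min_eq_right ht1.le]
      have e2 : ∫ u in (1 : ℝ)..t, ‖h u‖ = 0 := by
        rw [intervalIntegral.integral_of_le ht1.le]
        refine setIntegral_eq_zero_of_forall_eq_zero fun u hu => ?_
        rw [h0 u fun hu' => absurd hu.1 (not_lt.2 hu'.2), norm_zero]
      have e3 := hNsub 1 t
      rw [e2] at e3
      rw [e1, hmain 1 ⟨zero_le_one, le_rfl⟩]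
      linarith

/-- The variation is continuous, so taking right limits changes nothing and the two measures agree
on half-open intervals. -/
theorem variationMeasure_eq_withDensity [InnerProductSpace ℝ E] [CompleteSpace E] {k h : ℝ → E}
    (hi : Integrable h) (hbv : BoundedVariationOn k (Icc 0 1))
    (hV : ∀ t, totalVariation k t = ∫ u in (0 : ℝ)..t, ‖h u‖) :
    variationMeasure k hbv = volume.withDensity fun u => ‖h u‖ₑ := by
  have hii : ∀ a b, IntervalIntegrable (fun u => ‖h u‖) volume a b := fun a b =>
    hi.norm.intervalIntegrable
  have hc : Continuous (totalVariation k) := by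
    rw [funext hV]
    exact intervalIntegral.continuous_primitive hii 0
  have hst : ∀ t, (monotone_totalVariation hbv).stieltjesFunction t = totalVariation k t := by
    intro t
    rw [Monotone.stieltjesFunction_eq]
    exact hc.continuousWithinAt.rightLim_eq
  have : IsLocallyFiniteMeasure (variationMeasure k hbv) := by
    unfold variationMeasure
    infer_instance
  refine Measure.ext_of_Ioc _ _ fun a b hab => ?_
  rw [variationMeasure, StieltjesFunction.measure_Ioc, hst, hst, hV, hV,
    intervalIntegral.integral_interval_sub_left (hii _ _) (hii _ _),
    withDensity_apply _ measurableSet_Ioc, intervalIntegral.integral_of_le hab.le,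
    ofReal_integral_norm_eq_lintegral_enorm hi.integrableOn]

/-- The limit of the normal cone inequalities on short intervals. -/
theorem cone_inequality_of_hasDerivAt [InnerProductSpace ℝ E] {k : ℝ → E} {Γ : ℝ → ℝ} {p y v : E}
    {C₀ c t : ℝ} (hk : HasDerivAt k v t) (hΓ : HasDerivAt Γ c t)
    (h : ∀ᶠ s in nhdsWithin t (Ioi t),
      0 ≤ inner ℝ (p - y) (k s - k t) + coneDefect C₀ ‖p - y‖ (Γ s - Γ t)) :
    0 ≤ inner ℝ (p - y) v + C₀ * c * ‖p - y‖ ^ 2 := by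
  have hsub : nhdsWithin t (Ioi t) ≤ nhdsWithin t {t}ᶜ :=
    nhdsWithin_mono t fun s (hs : t < s) => hs.ne'
  have hk' := (hasDerivAt_iff_tendsto_slope.1 hk).mono_left hsub
  have hΓ' := (hasDerivAt_iff_tendsto_slope.1 hΓ).mono_left hsub
  have hΓ0 : Filter.Tendsto (fun s => Γ s - Γ t) (nhdsWithin t (Ioi t)) (nhds 0) := by
    have := (hΓ.continuousAt.tendsto.sub_const (Γ t)).mono_left
      (nhdsWithin_le_nhds (s := Ioi t))
    rwa [sub_self] at this
  have hlim := ((tendsto_const_nhds (x := p - y)).inner hk').add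
    ((((((hΓ0.const_mul 2).const_add ‖p - y‖).pow 2).const_mul C₀).add (hΓ0.const_mul 2)).mul hΓ')
  -- After division by `s - t`, only the part of the defect that is linear in the mass survives.
  have e : inner ℝ (p - y) v + C₀ * c * ‖p - y‖ ^ 2 =
      inner ℝ (p - y) v + (C₀ * (‖p - y‖ + 2 * 0) ^ 2 + 2 * 0) * c := by ring
  rw [e]
  refine ge_of_tendsto hlim ?_
  filter_upwards [h, self_mem_nhdsWithin] with s hs hts
  have hpos : 0 < s - t := sub_pos.2 hts
  have hinv : 0 ≤ (s - t)⁻¹ := by positivity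
  rw [slope_def_module, slope_def_module, real_inner_smul_right, smul_eq_mul]
  have := mul_nonneg hinv hs
  unfold coneDefect at this
  linarith

end ReflectedSkeleton

/-! ### Existence of solutions. -/

namespace ReflectedSkeleton

variable {E : Type*} [NormedAddCommGroup E] [InnerProductSpace ℝ E] [CompleteSpace E]

theorem isCatchingUpData_drift [FiniteDimensional ℝ E] {O : Set E} (hO : IsOpen O)
    (hO_bdd : Bornology.IsBounded O) {C₀ : ℝ} (hC₀ : 0 ≤ C₀) (hineq : NormalInequality O C₀)
    (hchar : NormalCharacterization O) {b : E → E} {σ : E → E →L[ℝ] E} {B S : ℝ}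
    (hB : ∀ x, ‖b x‖ ≤ B) {K K' : NNReal} (hK : LipschitzWith K b) (hS : ∀ x, ‖σ x‖ ≤ S)
    (hK' : LipschitzWith K' σ) {ψ : ℝ → E} (hψ : Integrable ψ) :
    IsCatchingUpData (closure O) C₀ (fun u z => b z + σ z (ψ u)) (fun u => B + S * ‖ψ u‖)
      (fun u => K + K' * ‖ψ u‖) where
  C₀_nonneg := hC₀
  isCompact :=
    have := FiniteDimensional.proper_real E
    hO_bdd.isCompact_closure
  step z hz v := exists_projection_step hO hC₀ hineq hchar hz v
  intervalIntegrable z p q hz := by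
    rw [intervalIntegrable_iff]
    have hbm := hK.continuous.comp_aestronglyMeasurable hz
    have hσm := (ContinuousLinearMap.apply ℝ E).flip.aestronglyMeasurable_comp₂
      (hK'.continuous.comp_aestronglyMeasurable hz) hψ.aestronglyMeasurable.restrict
    refine Integrable.mono' (g := fun u => B + S * ‖ψ u‖) ?_ (hbm.add hσm) ?_
    · have hc : IntegrableOn (fun _ : ℝ => B) (uIoc p q) := by simp
      exact hc.add (hψ.norm.const_mul S).integrableOn
    · exact Filter.Eventually.of_forall fun u =>
        (norm_add_le _ _).trans (add_le_add (hB _) ((σ _).le_of_opNorm_le (hS _) _))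
  norm_le u z := (norm_add_le _ _).trans (add_le_add (hB _) ((σ _).le_of_opNorm_le (hS _) _))
  field_lipschitz u z z' := by
    have e : b z + σ z (ψ u) - (b z' + σ z' (ψ u)) = (b z - b z') + (σ z - σ z') (ψ u) := by
      rw [sub_apply]
      abel
    rw [e]
    have h1 : ‖b z - b z'‖ ≤ K * ‖z - z'‖ := by
      simpa [dist_eq_norm] using hK.dist_le_mul z z'
    have h2 : ‖σ z - σ z'‖ ≤ K' * ‖z - z'‖ := by
      simpa [dist_eq_norm] using hK'.dist_le_mul z z'
    refine (norm_add_le _ _).trans ?_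
    have := (σ z - σ z').le_of_opNorm_le h2 (ψ u)
    linarith
  L_nonneg u := by positivity
  intervalIntegrable_G p q :=
    intervalIntegrable_const.add (hψ.norm.const_mul S).intervalIntegrable
  intervalIntegrable_L p q :=
    intervalIntegrable_const.add (hψ.norm.const_mul (K' : ℝ)).intervalIntegrable

/-- A normal cone inequality forces a density to be carried by the boundary, with the direction of
the outward normal. -/
theorem density_eq_norm_smul_normal {O : Set E} (hO : IsOpen O) {C : ℝ} (hC : 0 ≤ C)
    (hchar : NormalCharacterization O) {ξ : E → E}
    (hξ : ∀ y ∈ frontier O, ξ y ∈ outwardNormals O y) {p v : E} (hp : p ∈ closure O)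
    (h : ∀ y ∈ closure O, 0 ≤ inner ℝ (p - y) v + C * ‖p - y‖ ^ 2) :
    (v ≠ 0 → p ∈ frontier O) ∧ v = ‖v‖ • ξ p := by
  by_cases hpO : p ∈ O
  · have hv := eq_zero_of_forall_inner_add_sq_nonneg hO hpO h
    simp [hv]
  · have hfr : p ∈ frontier O := by rw [hO.frontier_eq]; exact ⟨hp, hpO⟩
    refine ⟨fun _ => hfr, ?_⟩
    obtain ⟨θ, hθ, ν, hν, hk⟩ := hchar p hfr v ⟨C, hC, h⟩
    rw [outwardNormals_unique hO (hξ p hfr) hν]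
    conv_lhs => rw [hk]
    rw [hk, norm_smul, norm_eq_one_of_mem_outwardNormals hν, mul_one, Real.norm_of_nonneg hθ]

theorem exists_skeletonSolution [FiniteDimensional ℝ E] {O : Set E} (hO : IsOpen O)
    (hO_bdd : Bornology.IsBounded O) (hO_smooth : HasSmoothBoundary O)
    {C₀ : ℝ} (hC₀ : 0 ≤ C₀) (hineq : NormalInequality O C₀)
    (hchar : NormalCharacterization O) {b : E → E} {σ : E → E →L[ℝ] E} {B S : ℝ}
    (hB : ∀ x, ‖b x‖ ≤ B) {K K' : NNReal} (hK : LipschitzWith K b) (hS : ∀ x, ‖σ x‖ ≤ S)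
    (hK' : LipschitzWith K' σ) {ψ : ℝ → E} (hψ : IntegrableOn ψ (Ioc 0 1)) {x : E}
    (hx : x ∈ closure O) : ∃ z k, IsSkeletonSolution O b σ x ψ z k := by
  -- Truncation makes the control integrable on the whole line, as the scheme requires.
  set ψ' := (Ioc (0 : ℝ) 1).indicator ψ with hψ'
  have hdata := isCatchingUpData_drift hO hO_bdd hC₀ hineq hchar hB hK hS hK'
    ((integrable_indicator_iff measurableSet_Ioc).2 hψ)
  obtain ⟨z, k, hzc, hzK, hk0, hzeq, hest⟩ := hdata.exists_limit hx
  set G : ℝ → ℝ := fun u => B + S * ‖ψ' u‖ with hG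
  have hGi := hdata.intervalIntegrable_G
  obtain ⟨h, hm, hi, h0, hd, hkh⟩ := exists_density hGi
    fun s t hs hst ht => (hest s t hs hst ht _ rfl).1
  obtain ⟨hbv, hV⟩ := totalVariation_eq_integral hi h0 hd hkh
  obtain ⟨ξ, hξ⟩ := exists_normalField hO_smooth
  have hcone : ∀ᵐ t, t ∈ Ioo (0 : ℝ) 1 →
      (h t ≠ 0 → z t ∈ frontier O) ∧ h t = ‖h t‖ • ξ (z t) := by
    filter_upwards [hd, (hGi 0 1).ae_hasDerivAt_integral] with t ht1 ht2 ht
    have htu : t ∈ uIcc (0 : ℝ) 1 := by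
      rw [uIcc_of_le zero_le_one]
      exact Ioo_subset_Icc_self ht
    -- The exceptional null set comes from the differentiability of `k` and of the integral of `G`
    -- alone, so at a good time the inequality holds for all `y` at once.
    refine density_eq_norm_smul_normal hO (C := C₀ * G t)
      (mul_nonneg hC₀ (hdata.G_nonneg t)) hchar hξ (hzK t) fun y hy => ?_
    refine cone_inequality_of_hasDerivAt (ht1 ht) (ht2 htu 0 left_mem_uIcc) ?_
    filter_upwards [Ioo_mem_nhdsGT ht.2] with s hs
    exact (hest t s ht.1.le hs.1.le hs.2.le _
      (intervalIntegral.integral_interval_sub_left (hGi _ _) (hGi _ _))).2 y hy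
  have hcone' : ∀ᵐ t, (h t ≠ 0 → z t ∈ frontier O) ∧ h t = ‖h t‖ • ξ (z t) := by
    filter_upwards [ae_Ioo_of_Icc hcone] with t ht
    by_cases htm : t ∈ Ioc (0 : ℝ) 1
    · exact ht htm
    · simp [h0 t htm]
  have hμ := variationMeasure_eq_withDensity hi hbv hV
  have hnm : Measurable fun u => ‖h u‖₊ := hm.nnnorm.measurable
  have hsm : (fun u => ‖h u‖₊ • ξ (z u)) =ᵐ[volume] h := by
    filter_upwards [hcone'] with t ht
    exact ht.2.symm
  have hbdry : ∀ᵐ u ∂variationMeasure k hbv, z u ∈ frontier O := by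
    rw [hμ, ae_withDensity_iff hm.enorm]
    filter_upwards [hcone'] with t ht hne
    exact ht.1 (by simpa using hne)
  have hkc : ContinuousOn k (Icc 0 1) :=
    (absolutelyContinuousOnInterval_of_norm_sub_le zero_le_one (hGi 0 1)
      fun s t hs hst ht => (hest s t hs hst ht _ rfl).1).continuousOn.mono
        (uIcc_of_le (zero_le_one (α := ℝ))).ge
  refine ⟨z, k, hzc, hkc, fun t _ => hzK t, hk0, ?_, hbv, ⟨ξ, hξ, ?_, ?_⟩, ?_⟩
  · intro t ht
    have hsub : Ioc 0 t ⊆ Ioc (0 : ℝ) 1 := Ioc_subset_Ioc_right ht.2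
    have hψe : ∀ u ∈ Ioc 0 t, ψ' u = ψ u := fun u hu => indicator_of_mem (hsub hu) _
    obtain ⟨i1, i2⟩ := integrableOn_drift hK.continuous hK'.continuous
      (hzc.mono (Icc_subset_Icc_right ht.2)) (hψ.mono_set hsub)
    have e := hzeq t ht
    rw [intervalIntegral.integral_of_le ht.1] at e
    rw [e, intervalIntegral.integral_of_le ht.1, intervalIntegral.integral_of_le ht.1,
      add_assoc x, ← integral_add i1 i2, setIntegral_congr_fun measurableSet_Ioc fun u hu => ?_]
    exact congrArg (fun p => b (z u) + σ (z u) p) (hψe u hu)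
  · rw [hμ]
    refine Integrable.integrableOn ((integrable_withDensity_iff_integrable_smul hnm).2 ?_)
    exact hi.congr hsm.symm
  · intro t ht
    rw [hμ, hkh t ht, hk0, zero_add, intervalIntegral.integral_of_le ht.1]
    refine Eq.trans ?_ (setIntegral_withDensity_eq_setIntegral_smul hnm _ measurableSet_Icc).symm
    rw [← integral_Icc_eq_integral_Ioc]
    exact (integral_congr_ae (ae_restrict_of_ae hsm)).symm
  · intro t ht
    have e : ∫⁻ s in Icc 0 t, {u | z u ∈ frontier O}.indicator 1 s ∂(variationMeasure k hbv) =
        ∫⁻ _ in Icc 0 t, 1 ∂(variationMeasure k hbv) := by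
      refine lintegral_congr_ae (ae_restrict_of_ae ?_)
      filter_upwards [hbdry] with u hu
      simp [indicator, hu]
    rw [e, setLIntegral_one, hμ, withDensity_apply _ measurableSet_Icc, hV t,
      intervalIntegral.integral_of_le ht.1, ← integral_Icc_eq_integral_Ioc,
      ofReal_integral_norm_eq_lintegral_enorm hi.integrableOn]

theorem supNorm_sq_le {F : Type*} [NormedAddCommGroup F] {f : ℝ → F} {t X : ℝ}
    (hX : ∀ s ∈ Icc (0 : ℝ) t, ‖f s‖ ^ 2 ≤ X) (h0 : 0 ≤ X) :
    supNorm f t ^ 2 ≤ ENNReal.ofReal X := by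
  have h1 : supNorm f t ≤ ENNReal.ofReal (√X) := by
    refine iSup₂_le fun s hs => ?_
    rw [← ofReal_norm]
    exact ENNReal.ofReal_le_ofReal (Real.le_sqrt_of_sq_le (hX s hs))
  calc supNorm f t ^ 2 ≤ ENNReal.ofReal (√X) ^ 2 := by gcongr
    _ = ENNReal.ofReal X := by rw [← ENNReal.ofReal_pow (Real.sqrt_nonneg X), Real.sq_sqrt h0]

end ReflectedSkeleton

end

/-! ### The main theorem. -/

open MeasureTheory Set ReflectedSkeleton in
theorem theorem2p1 {d : ℕ} (O : Set (EuclideanSpace ℝ (Fin d)))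
    (hO_open : IsOpen O) (hO_bdd : Bornology.IsBounded O) (hO_smooth : HasSmoothBoundary O)
    (C₀ : ℝ) (hC₀ : 0 ≤ C₀) (hO_ineq : NormalInequality O C₀)
    (hO_char : NormalCharacterization O)
    (φ : EuclideanSpace ℝ (Fin d) → ℝ) (hφ : IsCb2 φ) (α : ℝ) (hα : 0 < α)
    (hφ_normal : ∀ x ∈ frontier O, ∀ ζ ∈ outwardNormals O x,
      inner ℝ (gradient φ x) ζ ≤ -α * C₀)
    (b : EuclideanSpace ℝ (Fin d) → EuclideanSpace ℝ (Fin d))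
    (σ : EuclideanSpace ℝ (Fin d) → EuclideanSpace ℝ (Fin d) →L[ℝ] EuclideanSpace ℝ (Fin d))
    (hb_bdd : ∃ M : ℝ, ∀ x, ‖b x‖ ≤ M) (hb_lip : ∃ K, LipschitzWith K b)
    (hσ_bdd : ∃ M : ℝ, ∀ x, ‖σ x‖ ≤ M) (hσ_lip : ∃ K, LipschitzWith K σ) :
    (∀ x ∈ closure O, ∀ ψ : ℝ → EuclideanSpace ℝ (Fin d),
      MemLp ψ 2 (volume.restrict (Icc 0 1)) →
        (∃ z k, IsSkeletonSolution O b σ x ψ z k) ∧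
        ∀ z k z' k', IsSkeletonSolution O b σ x ψ z k → IsSkeletonSolution O b σ x ψ z' k' →
          EqOn z z' (Icc 0 1) ∧ EqOn k k' (Icc 0 1)) ∧
    ∀ r : ℝ, 0 < r → ∃ c : ℝ, 0 < c ∧
      ∀ x ∈ closure O, ∀ ψ₁ ψ₂ : ℝ → EuclideanSpace ℝ (Fin d),
        MemLp ψ₁ 2 (volume.restrict (Icc 0 1)) → MemLp ψ₂ 2 (volume.restrict (Icc 0 1)) →
        ∫ s in (0 : ℝ)..1, ‖ψ₁ s‖ ^ 2 ≤ r → ∫ s in (0 : ℝ)..1, ‖ψ₂ s‖ ^ 2 ≤ r →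
        ∀ z₁ k₁ z₂ k₂, IsSkeletonSolution O b σ x ψ₁ z₁ k₁ →
          IsSkeletonSolution O b σ x ψ₂ z₂ k₂ →
          ∀ t ∈ Icc (0 : ℝ) 1,
            supNorm (fun s => z₁ s - z₂ s) t ^ 2 ≤
              ENNReal.ofReal c * ∫⁻ s in Icc 0 t, ‖ψ₁ s - ψ₂ s‖ₑ ^ 2 ∧
            supNorm (fun s => z₁ s - z₂ s) t ^ 2 ≤
              ENNReal.ofReal c * ∫⁻ s in Icc 0 t, supNorm (fun u => ψ₁ u - ψ₂ u) s ^ 2 := by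
  have hstab := stability hα hO_ineq hφ hφ_normal hb_bdd hb_lip hσ_bdd hσ_lip
  refine ⟨fun x hx ψ hψ => ⟨?_, fun z k z' k' hz hz' => ?_⟩, fun r _ => ?_⟩
  · obtain ⟨B, hB⟩ := hb_bdd
    obtain ⟨K, hK⟩ := hb_lip
    obtain ⟨S, hS⟩ := hσ_bdd
    obtain ⟨K', hK'⟩ := hσ_lip
    exact exists_skeletonSolution hO_open hO_bdd hO_smooth hC₀ hO_ineq hO_char hB hK hS hK'
      (integrableOn_of_memLp_two hψ).1 hx
  -- Uniqueness is stability for equal controls, with `r` the squared norm of `ψ`; the equation then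
  -- determines `k`.
  · obtain ⟨c, -, hc⟩ := hstab (∫ s in (0 : ℝ)..1, ‖ψ s‖ ^ 2)
    have hzz : EqOn z z' (Icc 0 1) := fun t ht => by
      have := hc x ψ ψ hψ hψ le_rfl le_rfl z k z' k' hz hz' t ht
      simp only [sub_self, norm_zero, ne_eq, OfNat.ofNat_ne_zero, not_false_eq_true, zero_pow,
        integral_zero, mul_zero] at this
      exact sub_eq_zero.1 (norm_eq_zero.1 (pow_eq_zero_iff two_ne_zero |>.1
        (le_antisymm this (sq_nonneg _))))
    refine ⟨hzz, fun t ht => ?_⟩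
    have hcongr : ∀ s ∈ uIcc 0 t, z s = z' s := by
      rw [uIcc_of_le ht.1]
      exact fun s hs => hzz ⟨hs.1, hs.2.trans ht.2⟩
    have e1 := hz.equation t ht
    have e2 := hz'.equation t ht
    rw [intervalIntegral.integral_congr (g := fun s => b (z' s))
        fun s hs => congrArg b (hcongr s hs),
      intervalIntegral.integral_congr (g := fun s => σ (z' s) (ψ s))
        fun s hs => congrArg (fun y => σ y (ψ s)) (hcongr s hs), hzz ht, e2] at e1
    exact (sub_right_inj.1 e1).symm
  · obtain ⟨c, hc0, hc⟩ := hstab r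
    refine ⟨c, hc0, fun x _ ψ₁ ψ₂ hψ₁ hψ₂ hr₁ hr₂ z₁ k₁ z₂ k₂ hz₁ hz₂ t ht => ?_⟩
    have hi : IntegrableOn (fun s => ‖ψ₁ s - ψ₂ s‖ ^ 2) (Ioc 0 1) :=
      (integrableOn_of_memLp_two (hψ₁.sub hψ₂)).2
    have hit := hi.mono_set (Ioc_subset_Ioc_right ht.2)
    have hX : ∀ s ∈ Icc (0 : ℝ) t,
        ‖z₁ s - z₂ s‖ ^ 2 ≤ c * ∫ u in Ioc 0 t, ‖ψ₁ u - ψ₂ u‖ ^ 2 := fun s hs => by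
      refine (hc x ψ₁ ψ₂ hψ₁ hψ₂ hr₁ hr₂ z₁ k₁ z₂ k₂ hz₁ hz₂ s ⟨hs.1, hs.2.trans ht.2⟩).trans ?_
      refine mul_le_mul_of_nonneg_left ?_ hc0.le
      exact setIntegral_mono_set hit (Filter.Eventually.of_forall fun _ => sq_nonneg _)
        (Ioc_subset_Ioc_right hs.2).eventuallyLE
    have hmain := supNorm_sq_le (f := fun s => z₁ s - z₂ s) hX
      (mul_nonneg hc0.le (integral_nonneg fun _ => sq_nonneg _))
    have hfirst : supNorm (fun s => z₁ s - z₂ s) t ^ 2 ≤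
        ENNReal.ofReal c * ∫⁻ s in Icc 0 t, ‖ψ₁ s - ψ₂ s‖ₑ ^ 2 := by
      refine hmain.trans_eq ?_
      rw [ENNReal.ofReal_mul hc0.le, ofReal_integral_eq_lintegral_ofReal hit
        (Filter.Eventually.of_forall fun _ => sq_nonneg _), restrict_Ioc_eq_restrict_Icc]
      congr 2
      ext s
      rw [ENNReal.ofReal_pow (norm_nonneg _), ofReal_norm]
    refine ⟨hfirst, hfirst.trans ?_⟩
    gcongr ENNReal.ofReal c * ?_
    -- The second estimate follows from the first, since `|ψ₁(s) - ψ₂(s)|` is one of the values in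
    -- the supremum over `[0, s]`.
    refine setLIntegral_mono' measurableSet_Icc fun s hs => ?_
    gcongr
    exact le_iSup₂ (f := fun u (_ : u ∈ Icc (0 : ℝ) s) => ‖ψ₁ u - ψ₂ u‖ₑ) s ⟨hs.1, le_rfl⟩
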